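/- Let $E=\mathbb{Q}(i)$ with ring of integers $\mathbb{Z}[i]$. For $n\in\mathbb{Z}$ let $\chi_n$ be the unramified Hecke character given on a non-zero ideal $\mathfrak a=(a)$ of $\mathbb{Z}[i]$ by $\chi_n(\mathfrak a)=(a/|a|)^{4n}$, and for $\operatorname{Re} s>1$ let $L(s,\chi_n)=\sum_{\mathfrak a\neq 0}\chi_n(\mathfrak a)N(\mathfrak a)^{-s}$, the sum (absolutely convergent) being over all non-zero ideals of $\mathbb{Z}[i]$. For $\operatorname{Re} s>1$ and $\operatorname{Re} w>1$ the double Dirichlet series $$D_E(s,w)=L(s,\chi_0)+\sum_{n\in\mathbb{Z}\setminus\{0\}}L(s,\chi_n)\,|n|^{-w}$$ converges absolutely. Then $D_E(s,w)$ extends to a meromorphic function on $\mathbb{C}^2$, and so does its normalized version $$\tilde D_E(s,w)=\frac{2^{w/2}}{\Gamma\left(\frac{1-w}{2}\right)}\,D_E(s,w).$$ The polar divisor of each of these two meromorphic functions is contained in the union of the line $s=1$ and of the lines $w=1-j$ and $w=2-2s-j$, $j=0,1,2,\dots$; that is, the extensions are holomorphic outside these lines. -/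

import Mathlib

open Complex

namespace GaussDDS

/-! ### Gaussian integers as a free `ℤ`-module (so that ideal norms are available) -/

/-- The additive isomorphism `x + y i ↦ (x, y)` from `ℤ[i]` to `ℤ × ℤ`. -/
def gaussEquiv : GaussianInt ≃ₗ[ℤ] ℤ × ℤ where
  toFun z := (z.re, z.im)
  invFun p := ⟨p.1, p.2⟩
  left_inv _ := rfl
  right_inv _ := rfl
  map_add' _ _ := rfl
  map_smul' n z := by
    ext <;> simp

instance instFree : Module.Free ℤ GaussianInt := Module.Free.of_equiv gaussEquiv.symm

instance instFinite : Module.Finite ℤ GaussianInt := Module.Finite.equiv gaussEquiv.symm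

/-! ### The unramified Hecke characters and their `L`-functions -/

/-- The type of non-zero ideals of `ℤ[i]`, the ring of integers of `ℚ(i)`. -/
abbrev NonzeroIdeal : Type := {I : Ideal GaussianInt // I ≠ ⊥}

/-- The angular function `z ↦ (z / |z|) ^ (4 n)` on Gaussian integers. -/
noncomputable def angular (n : ℤ) (z : GaussianInt) : ℂ :=
  (GaussianInt.toComplex z / (‖GaussianInt.toComplex z‖ : ℂ)) ^ (4 * n)

/-- The unramified Hecke character `χ_n((z)) = (z / |z|) ^ (4 n)` on ideals of `ℤ[i]`. It is
evaluated at a generator of the ideal; `chi_span` says that the choice is immaterial. -/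
noncomputable def chi (n : ℤ) (I : Ideal GaussianInt) : ℂ :=
  angular n (Submodule.IsPrincipal.generator I)

/-- The Hecke `L`-series `L(s, χ_n) = ∑ χ_n(I) N(I)^{-s}` over the non-zero ideals of `ℤ[i]`. -/
noncomputable def heckeL (n : ℤ) (s : ℂ) : ℂ :=
  ∑' I : NonzeroIdeal, chi n I.1 * (Ideal.absNorm I.1 : ℂ) ^ (-s)

/-- The double Dirichlet series
`D(s, w) = L(s, χ_0) + ∑_{n ≠ 0} L(s, χ_n) |n|^{-w}` in its domain of convergence. -/
noncomputable def doubleSeries (s w : ℂ) : ℂ :=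
  heckeL 0 s + ∑' n : {n : ℤ // n ≠ 0}, heckeL n.1 s * ((n.1.natAbs : ℕ) : ℂ) ^ (-w)

/-- The normalizing factor `2^{w/2} / Γ((1 - w)/2)`. Where `Γ((1 - w)/2)` has a pole,
`Complex.Gamma` is `0` by convention and the quotient is `0`, the value of the entire
function `2^{w/2} · (1/Γ)((1 - w)/2)`. -/
noncomputable def normFactor (w : ℂ) : ℂ :=
  (2 : ℂ) ^ (w / 2) / Complex.Gamma ((1 - w) / 2)

/-! ### Meromorphic functions of two variables -/

/-- `F` is meromorphic on `ℂ²`: near every point `p` it is a quotient `g / h` of two functions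
analytic at `p`, where `h` is not identically zero near `p`. The values of `F` on the thin
set `h = 0` are irrelevant. -/
def IsMeromorphic (F : ℂ × ℂ → ℂ) : Prop :=
  ∀ p : ℂ × ℂ, ∃ g h : ℂ × ℂ → ℂ, AnalyticAt ℂ g p ∧ AnalyticAt ℂ h p ∧
    (¬ ∀ᶠ x in nhds p, h x = 0) ∧ ∀ᶠ x in nhds p, h x ≠ 0 → F x = g x / h x

/-- The union of the line `s = 1` and of the lines `w = 1 - j` and `w = 2 - 2 s - j`, `j ≥ 0`. -/
def polarLines : Set (ℂ × ℂ) :=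
  {p | p.1 = 1 ∨ (∃ j : ℕ, p.2 = 1 - (j : ℂ)) ∨ ∃ j : ℕ, p.2 = 2 - 2 * p.1 - (j : ℂ)}

/-! ### The character and the norm on a principal ideal -/

theorem isUnit_pow_four {u : GaussianInt} (hu : IsUnit u) : u ^ 4 = 1 := by
  have hn : u.norm = 1 := by
    have h := Zsqrtd.norm_eq_one_iff.2 hu
    have h0 : 0 ≤ u.norm := GaussianInt.norm_nonneg u
    omega
  rcases u with ⟨a, b⟩
  have hab : a * a + b * b = 1 := by
    have : a * a - (-1) * b * b = 1 := hn
    linarith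
  have ha1 : a ≤ 1 := by nlinarith
  have ha2 : -1 ≤ a := by nlinarith
  have hb1 : b ≤ 1 := by nlinarith
  have hb2 : -1 ≤ b := by nlinarith
  interval_cases a <;> interval_cases b <;> simp_all <;> decide

theorem angular_mul_unit (n : ℤ) (z : GaussianInt) {u : GaussianInt} (hu : IsUnit u) :
    angular n (z * u) = angular n z := by
  have h4 : (GaussianInt.toComplex u) ^ 4 = 1 := by
    rw [← map_pow, isUnit_pow_four hu, map_one]
  have hnorm : ‖GaussianInt.toComplex u‖ = 1 := by
    have h : ‖GaussianInt.toComplex u‖ ^ 4 = 1 := by rw [← norm_pow, h4, norm_one]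
    exact (pow_eq_one_iff_of_nonneg (norm_nonneg _) (by norm_num)).1 h
  have h4' : (GaussianInt.toComplex u) ^ (4 * n) = 1 := by
    rw [zpow_mul]
    have : (GaussianInt.toComplex u) ^ (4 : ℤ) = 1 := by exact_mod_cast h4
    rw [this, one_zpow]
  unfold angular
  rw [map_mul, norm_mul, hnorm, mul_one, mul_div_right_comm, mul_zpow, h4', mul_one]

/-- The Hecke character does not depend on the generator. -/
theorem chi_span (n : ℤ) (z : GaussianInt) : chi n (Ideal.span {z}) = angular n z := by
  obtain ⟨u, hu⟩ : Associated z (Submodule.IsPrincipal.generator (Ideal.span {z})) := by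
    rw [← Ideal.span_singleton_eq_span_singleton, Ideal.span_singleton_generator]
  unfold chi
  rw [← hu, angular_mul_unit n z u.isUnit]

/-- The norm of the ideal generated by `z` is `|z|²`. -/
theorem absNorm_span (z : GaussianInt) :
    Ideal.absNorm (Ideal.span {z}) = z.norm.natAbs := by
  rw [Ideal.absNorm_span_singleton]
  congr 1
  let b : Module.Basis (Fin 2) ℤ GaussianInt :=
    (Module.Basis.finTwoProd ℤ).map gaussEquiv.symm
  rw [Algebra.norm_eq_matrix_det b, Matrix.det_fin_two]
  have h0 : b 0 = ⟨1, 0⟩ := by simp [b]; rfl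
  have h1 : b 1 = ⟨0, 1⟩ := by simp [b]; rfl
  have hr0 : ∀ x, b.repr x 0 = x.re := fun x => by simp [b, gaussEquiv]
  have hr1 : ∀ x, b.repr x 1 = x.im := fun x => by simp [b, gaussEquiv]
  simp only [Algebra.leftMulMatrix_eq_repr_mul, h0, h1, hr0, hr1, Zsqrtd.norm_def]
  simp

end GaussDDS

namespace GaussDDS
section
open MeasureTheory Filter Topology Set

/-! ### Holomorphic functions of two variables -/

theorem aestronglyMeasurable_fderiv_apply {α : Type*} [MeasurableSpace α] {μ : Measure α}
    {F : ℂ × ℂ → α → ℂ} {U : Set (ℂ × ℂ)} (hU : IsOpen U)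
    (hmeas : ∀ p ∈ U, AEStronglyMeasurable (F p) μ)
    (hdiff : ∀ᵐ a ∂μ, DifferentiableOn ℂ (F · a) U) {p : ℂ × ℂ} (hp : p ∈ U) (v : ℂ × ℂ) :
    AEStronglyMeasurable (fun a => fderiv ℂ (F · a) p v) μ := by
  have hlim : Tendsto (fun n : ℕ => ((n : ℂ) + 1)⁻¹) atTop (𝓝 0) := by
    simpa using tendsto_one_div_add_atTop_nhds_zero_nat (𝕜 := ℂ)
  have hpath : Tendsto (fun n : ℕ => p + ((n : ℂ) + 1)⁻¹ • v) atTop (𝓝 p) := by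
    simpa using tendsto_const_nhds.add (hlim.smul_const v)
  obtain ⟨N, hN⟩ := eventually_atTop.1 (hpath.eventually (hU.mem_nhds hp))
  refine aestronglyMeasurable_of_tendsto_ae (u := (atTop : Filter ℕ))
    (f := fun n a => ((n + N : ℕ) + 1 : ℂ) • (F (p + ((n + N : ℕ) + 1 : ℂ)⁻¹ • v) a - F p a)) ?_ ?_
  · intro n
    have h := (hmeas _ (hN (n + N) (Nat.le_add_left N n))).sub (hmeas _ hp)
    exact h.const_smul ((n + N : ℕ) + 1 : ℂ)
  · filter_upwards [hdiff] with a ha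
    have hd := ((ha p hp).differentiableAt (hU.mem_nhds hp)).hasFDerivAt
    have hc : Tendsto (fun n : ℕ => ‖(n : ℂ) + 1‖) atTop atTop := by
      have : ∀ n : ℕ, ‖(n : ℂ) + 1‖ = n + 1 := fun n => by
        rw [← Nat.cast_add_one, Complex.norm_natCast]; push_cast; rfl
      simp only [this]
      exact tendsto_atTop_add_const_right _ _ tendsto_natCast_atTop_atTop
    exact (tendsto_add_atTop_iff_nat N).2 (hd.lim v hc)

/-- An integral of holomorphic functions of two variables, locally uniformly dominated, is
holomorphic. -/
theorem differentiableOn_integral_of_dominated {α : Type*} [MeasurableSpace α] {μ : Measure α}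
    {F : ℂ × ℂ → α → ℂ} {U : Set (ℂ × ℂ)} (hU : IsOpen U)
    (hmeas : ∀ p ∈ U, AEStronglyMeasurable (F p) μ)
    (hdiff : ∀ᵐ a ∂μ, DifferentiableOn ℂ (F · a) U)
    (hbound : ∀ p ∈ U, ∃ V ∈ 𝓝 p, ∃ b : α → ℝ, Integrable b μ ∧
      ∀ᵐ a ∂μ, ∀ q ∈ V, ‖F q a‖ ≤ b a) :
    DifferentiableOn ℂ (fun p => ∫ a, F p a ∂μ) U := by
  intro p hp
  obtain ⟨V, hV, b, hb, hFb⟩ := hbound p hp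
  obtain ⟨ε, hε, hball⟩ := Metric.mem_nhds_iff.1 (inter_mem hV (hU.mem_nhds hp))
  have hε2 : 0 < ε / 2 := half_pos hε
  refine DifferentiableAt.differentiableWithinAt (HasFDerivAt.differentiableAt
    (hasFDerivAt_integral_of_dominated_of_fderiv_le (F := F)
    (F' := fun q a => fderiv ℂ (F · a) q) (bound := fun a => 2 * b a / (ε / 2))
    (Metric.ball_mem_nhds p hε2) ?_ ?_ ?_ ?_ ?_ ?_))
  · filter_upwards [hU.mem_nhds hp] with q hq using hmeas q hq
  · exact hb.mono' (hmeas p hp) (hFb.mono fun a ha => ha p (mem_of_mem_nhds hV))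
  · have h1 := (aestronglyMeasurable_fderiv_apply hU hmeas hdiff hp (1, 0)).smul_const
      (ContinuousLinearMap.fst ℂ ℂ ℂ)
    have h2 := (aestronglyMeasurable_fderiv_apply hU hmeas hdiff hp (0, 1)).smul_const
      (ContinuousLinearMap.snd ℂ ℂ ℂ)
    refine (h1.add h2).congr (Eventually.of_forall fun a => ?_)
    ext <;> simp
  · filter_upwards [hdiff, hFb] with a ha hab q hq
    have hsub : Metric.ball q (ε / 2) ⊆ Metric.ball p ε :=
      Metric.ball_subset_ball' (by rw [Metric.mem_ball] at hq; linarith)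
    refine norm_fderiv_le_div_of_mapsTo_ball (R₁ := ε / 2)
      (ha.mono (hsub.trans (hball.trans inter_subset_right))) (fun z hz => ?_) hε2
    have h1 := hab z (hball (hsub hz)).1
    have h2 := hab q (hball (hsub (Metric.mem_ball_self hε2))).1
    rw [mem_closedBall_iff_norm]
    exact (norm_sub_le _ _).trans (by linarith)
  · exact (hb.const_mul 2).div_const _
  · filter_upwards [hdiff] with a ha q hq
    have hqU : q ∈ U := (hball (Metric.ball_subset_ball (by linarith) hq)).2
    exact ((ha q hqU).differentiableAt (hU.mem_nhds hqU)).hasFDerivAt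

/-- Series version of `differentiableOn_integral_of_dominated`. -/
theorem differentiableOn_tsum_of_dominated {ι : Type*} [Countable ι]
    {F : ℂ × ℂ → ι → ℂ} {U : Set (ℂ × ℂ)} (hU : IsOpen U)
    (hdiff : ∀ i, DifferentiableOn ℂ (F · i) U)
    (hbound : ∀ p ∈ U, ∃ V ∈ 𝓝 p, ∃ b : ι → ℝ, Summable b ∧ ∀ i, ∀ q ∈ V, ‖F q i‖ ≤ b i) :
    DifferentiableOn ℂ (fun p => ∑' i, F p i) U := by
  let _ : MeasurableSpace ι := ⊤
  have key := differentiableOn_integral_of_dominated (μ := Measure.count) (F := F) hU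
    (fun p _ => (measurable_from_top).aestronglyMeasurable) (Eventually.of_forall hdiff) (by
      intro p hp
      obtain ⟨V, hV, b, hb, h⟩ := hbound p hp
      refine ⟨V, hV, b, ?_, Eventually.of_forall h⟩
      rw [integrable_count_iff]
      simpa using hb.norm)
  refine key.congr fun p hp => ?_
  obtain ⟨V, hV, b, hb, h⟩ := hbound p hp
  rw [integral_countable]
  · simp [Measure.real]
  · rw [integrable_count_iff]
    exact Summable.of_nonneg_of_le (fun _ => norm_nonneg _)
      (fun i => h i p (mem_of_mem_nhds hV)) hb

open scoped BoundedContinuousFunction Real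

/-- Integration over a period square, as a continuous linear form. -/
noncomputable def squareIntegral : ((ℝ × ℝ) →ᵇ ℂ) →L[ℂ] ℂ :=
  LinearMap.mkContinuous
    { toFun := fun φ => ∫ x in (0 : ℝ)..2 * π, ∫ y in (0 : ℝ)..2 * π, φ (x, y)
      map_add' := fun φ ψ => by
        have h : ∀ (φ : (ℝ × ℝ) →ᵇ ℂ) (x : ℝ),
            IntervalIntegrable (fun y => φ (x, y)) volume 0 (2 * π) := fun φ x =>
          (φ.continuous.comp (by fun_prop : Continuous fun y : ℝ => (x, y))).intervalIntegrable _ _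
        have h2 : ∀ (φ : (ℝ × ℝ) →ᵇ ℂ),
            IntervalIntegrable (fun x => ∫ y in (0 : ℝ)..2 * π, φ (x, y)) volume 0 (2 * π) :=
          fun φ => (intervalIntegral.continuous_parametric_intervalIntegral_of_continuous'
            (f := fun x y => φ (x, y)) φ.continuous _ _).intervalIntegrable _ _
        simp only [BoundedContinuousFunction.coe_add, Pi.add_apply]
        rw [← intervalIntegral.integral_add (h2 φ) (h2 ψ)]
        exact intervalIntegral.integral_congr fun x _ =>
          intervalIntegral.integral_add (h φ x) (h ψ x)
      map_smul' := fun c φ => by simp }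
    ((2 * π) * (2 * π)) (fun φ => by
      have hpi : (0 : ℝ) ≤ 2 * π := by positivity
      have h1 : ∀ x : ℝ, ‖∫ y in (0 : ℝ)..2 * π, φ (x, y)‖ ≤ ‖φ‖ * (2 * π) := fun x => by
        simpa [abs_of_nonneg hpi, abs_of_pos Real.pi_pos] using
          intervalIntegral.norm_integral_le_of_norm_le_const
          (f := fun y => φ (x, y)) (a := 0) (b := 2 * π) (fun y _ => φ.norm_coe_le_norm (x, y))
      have h2 := intervalIntegral.norm_integral_le_of_norm_le_const
          (f := fun x => ∫ y in (0 : ℝ)..2 * π, φ (x, y)) (a := 0) (b := 2 * π) (fun x _ => h1 x)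
      rw [sub_zero, abs_of_nonneg hpi] at h2
      simp only [LinearMap.coe_mk, AddHom.coe_mk]
      linarith)

theorem squareIntegral_apply (φ : (ℝ × ℝ) →ᵇ ℂ) :
    squareIntegral φ = ∫ x in (0 : ℝ)..2 * π, ∫ y in (0 : ℝ)..2 * π, φ (x, y) := rfl

/-- The resolvent of a bounded continuous function that keeps away from a point depends
analytically on that point. -/
theorem exists_analyticAt_resolvent {X : Type*} [TopologicalSpace X] (u : X → ℂ)
    (hu : Continuous u) (c : ℂ) {r : ℝ} (hr : 0 < r) (hur : ∀ x, ‖u x - c‖ = r) :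
    ∃ k : ℂ → (X →ᵇ ℂ), AnalyticAt ℂ k c ∧ ∀ᶠ s in 𝓝 c, ∀ x, k s x = (u x - s)⁻¹ := by
  have hne : ∀ x, u x - c ≠ 0 := fun x h => by
    have := hur x; rw [h, norm_zero] at this; exact hr.ne this
  let a : X →ᵇ ℂ := BoundedContinuousFunction.ofNormedAddCommGroup u hu (r + ‖c‖) (fun x => by
    have := norm_add_le (u x - c) c
    rwa [sub_add_cancel, hur] at this)
  let b : X →ᵇ ℂ := BoundedContinuousFunction.ofNormedAddCommGroup (fun x => (u x - c)⁻¹)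
    ((hu.sub continuous_const).inv₀ hne) r⁻¹
    (fun x => by rw [norm_inv, hur])
  have hab : (a - c • 1) * b = 1 := by
    ext x
    simp [a, b, hne x]
  let U : (X →ᵇ ℂ)ˣ := ⟨a - c • 1, b, hab, by rw [mul_comm]; exact hab⟩
  have hU : (U : X →ᵇ ℂ) = a - c • 1 := rfl
  have hlin : AnalyticAt ℂ (fun s : ℂ => a - s • (1 : X →ᵇ ℂ)) c :=
    analyticAt_const.sub (analyticAt_id.smul analyticAt_const)
  refine ⟨fun s => Ring.inverse (a - s • 1), ?_, ?_⟩
  · have := analyticAt_inverse (𝕜 := ℂ) U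
    exact AnalyticAt.fun_comp (hU ▸ this) hlin
  · have hev : ∀ᶠ s in 𝓝 c, IsUnit (a - s • (1 : X →ᵇ ℂ)) :=
      hlin.continuousAt.eventually (Units.isOpen.mem_nhds U.isUnit)
    filter_upwards [hev] with s hs x
    have h1 := DFunLike.congr_fun (Ring.mul_inverse_cancel _ hs) x
    simp only [BoundedContinuousFunction.coe_mul, Pi.mul_apply, BoundedContinuousFunction.coe_one,
      Pi.one_apply] at h1
    have h2 : (a - s • (1 : X →ᵇ ℂ)) x = u x - s := by simp [a]
    rw [h2] at h1
    exact eq_inv_of_mul_eq_one_right h1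

/-- **Osgood's lemma**: a complex differentiable function of two variables is analytic. -/
theorem analyticAt_of_differentiableOn {F : ℂ × ℂ → ℂ} {U : Set (ℂ × ℂ)} (hU : IsOpen U)
    (hF : DifferentiableOn ℂ F U) {p : ℂ × ℂ} (hp : p ∈ U) : AnalyticAt ℂ F p := by
  obtain ⟨r, hr, hball⟩ := Metric.nhds_basis_closedBall.mem_iff.1 (hU.mem_nhds hp)
  obtain ⟨s₀, w₀⟩ := p
  rw [← closedBall_prod_same] at hball
  have hc : ∀ x : ℝ, ∀ c : ℂ, circleMap c r x ∈ Metric.closedBall c r := fun x c =>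
    circleMap_mem_closedBall c hr.le x
  have hcont : Continuous fun x : ℝ × ℝ => F (circleMap s₀ r x.1, circleMap w₀ r x.2) := by
    refine hF.continuousOn.comp_continuous (by fun_prop) fun x => hball ⟨hc _ _, hc _ _⟩
  obtain ⟨C, hC⟩ := ((isCompact_closedBall s₀ r).prod
    (isCompact_closedBall w₀ r)).exists_bound_of_continuousOn
    (hF.continuousOn.mono hball)
  let Φ : (ℝ × ℝ) →ᵇ ℂ := BoundedContinuousFunction.ofNormedAddCommGroup
    (fun x => (circleMap 0 r x.1 * I) * (circleMap 0 r x.2 * I) *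
      F (circleMap s₀ r x.1, circleMap w₀ r x.2))
    (((((continuous_circleMap 0 r).comp continuous_fst).mul continuous_const).mul
      (((continuous_circleMap 0 r).comp continuous_snd).mul continuous_const)).mul hcont)
    (r * r * C) (fun x => by
      rw [norm_mul, norm_mul]
      simp only [norm_mul, norm_circleMap_zero, norm_I, mul_one, abs_of_pos hr]
      exact mul_le_mul_of_nonneg_left (hC _ ⟨hc _ _, hc _ _⟩) (by positivity))
  obtain ⟨k₁, hk₁, he₁⟩ := exists_analyticAt_resolvent (X := ℝ × ℝ) (fun x => circleMap s₀ r x.1)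
    (by fun_prop) s₀ hr (fun x => by simp [circleMap, abs_of_pos hr])
  obtain ⟨k₂, hk₂, he₂⟩ := exists_analyticAt_resolvent (X := ℝ × ℝ) (fun x => circleMap w₀ r x.2)
    (by fun_prop) w₀ hr (fun x => by simp [circleMap, abs_of_pos hr])
  have hA : AnalyticAt ℂ (fun p : ℂ × ℂ => (2 * π * I : ℂ)⁻¹ * (2 * π * I : ℂ)⁻¹ *
      squareIntegral (k₁ p.1 * k₂ p.2 * Φ)) (s₀, w₀) := by
    refine analyticAt_const.mul (squareIntegral.analyticAt _ |>.fun_comp ?_)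
    refine AnalyticAt.mul (AnalyticAt.mul ?_ ?_) analyticAt_const
    · exact AnalyticAt.fun_comp (f := fun p : ℂ × ℂ => p.1) hk₁ analyticAt_fst
    · exact AnalyticAt.fun_comp (f := fun p : ℂ × ℂ => p.2) hk₂ analyticAt_snd
  refine hA.congr ?_
  have hmem : ∀ᶠ p : ℂ × ℂ in 𝓝 (s₀, w₀), p.1 ∈ Metric.ball s₀ r ∧ p.2 ∈ Metric.ball w₀ r := by
    rw [nhds_prod_eq]
    exact prod_mem_prod (Metric.ball_mem_nhds s₀ hr) (Metric.ball_mem_nhds w₀ hr)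
  have he₁' : ∀ᶠ p : ℂ × ℂ in 𝓝 (s₀, w₀), ∀ x, k₁ p.1 x = (circleMap s₀ r x.1 - p.1)⁻¹ :=
    (continuous_fst.tendsto (s₀, w₀)).eventually he₁
  have he₂' : ∀ᶠ p : ℂ × ℂ in 𝓝 (s₀, w₀), ∀ x, k₂ p.2 x = (circleMap w₀ r x.2 - p.2)⁻¹ :=
    (continuous_snd.tendsto (s₀, w₀)).eventually he₂
  filter_upwards [hmem, he₁', he₂'] with p hp h1 h2
  obtain ⟨s, w⟩ := p
  have hd1 : ∀ w ∈ Metric.closedBall w₀ r, DiffContOnCl ℂ (fun z => F (z, w)) (Metric.ball s₀ r) :=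
    fun w hw => DifferentiableOn.diffContOnCl_ball (U := Metric.closedBall s₀ r)
      (hF.comp (by fun_prop) fun z hz => hball ⟨hz, hw⟩) subset_rfl
  have hd2 : ∀ z ∈ Metric.closedBall s₀ r, DiffContOnCl ℂ (fun w => F (z, w)) (Metric.ball w₀ r) :=
    fun z hz => DifferentiableOn.diffContOnCl_ball (U := Metric.closedBall w₀ r)
      (hF.comp (by fun_prop) fun w hw => hball ⟨hz, hw⟩) subset_rfl
  have c1 := (hd1 w
      (Metric.ball_subset_closedBall hp.2)).two_pi_i_inv_smul_circleIntegral_sub_inv_smul hp.1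
  have c2 : ∀ z ∈ Metric.closedBall s₀ r, _ := fun z hz =>
    (hd2 z hz).two_pi_i_inv_smul_circleIntegral_sub_inv_smul hp.2
  change _ = F (s, w)
  rw [← c1, squareIntegral_apply]
  simp only [circleIntegral, deriv_circleMap, smul_eq_mul] at c2 ⊢
  rw [mul_assoc]
  congr 1
  rw [← intervalIntegral.integral_const_mul]
  refine intervalIntegral.integral_congr fun x _ => ?_
  rw [← c2 _ (hc x s₀),
    ← intervalIntegral.integral_const_mul, ← intervalIntegral.integral_const_mul,
    ← intervalIntegral.integral_const_mul, ← intervalIntegral.integral_const_mul]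
  refine intervalIntegral.integral_congr fun y _ => ?_
  simp only [BoundedContinuousFunction.coe_mul, Pi.mul_apply, h1, h2]
  simp only [Φ, BoundedContinuousFunction.coe_ofNormedAddCommGroup]
  ring

end
section
open MeasureTheory Filter Topology Set
open scoped Nat

/-! ### Euler–Maclaurin summation on the whole line -/

/-- The `k`-th periodic Bernoulli function, divided by `k!`. -/
noncomputable def bernoulliKernel (k : ℕ) (u : ℝ) : ℝ := bernoulliFun k (Int.fract u) / k !

theorem measurable_bernoulliKernel (k : ℕ) : Measurable (bernoulliKernel k) :=
  ((continuous_bernoulliFun k).measurable.comp measurable_fract).div_const _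

theorem exists_bound_bernoulliKernel (k : ℕ) : ∃ C : ℝ, 0 ≤ C ∧ ∀ u, ‖bernoulliKernel k u‖ ≤ C := by
  obtain ⟨C, hC⟩ := isCompact_Icc.exists_bound_of_continuousOn (s := Icc (0 : ℝ) 1)
    ((continuous_bernoulliFun k).div_const (k ! : ℝ)).continuousOn
  refine ⟨C, (norm_nonneg _).trans (hC 0 (by simp)), fun u =>
    hC _ ⟨Int.fract_nonneg u, (Int.fract_lt_one u).le⟩⟩

theorem integrable_bernoulliKernel_mul (k : ℕ) {f : ℝ → ℂ} (hf : Integrable f) :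
    Integrable fun u => (bernoulliKernel k u : ℂ) * f u := by
  obtain ⟨C, -, hC⟩ := exists_bound_bernoulliKernel k
  refine hf.bdd_mul (c := C) ?_ (Eventually.of_forall fun u => by simpa using hC u)
  exact (Complex.measurable_ofReal.comp (measurable_bernoulliKernel k)).aestronglyMeasurable

theorem integral_fract_cell (β : ℝ → ℝ) (f : ℝ → ℂ) (n : ℤ) :
    ∫ u in (n : ℝ)..n + 1, (β (Int.fract u) : ℂ) * f u =
      ∫ u in (n : ℝ)..n + 1, (β (u - n) : ℂ) * f u := by
  refine intervalIntegral.integral_congr_ae ?_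
  have h0 : ∀ᵐ u : ℝ, u ≠ n + 1 := by simp [ae_iff]
  filter_upwards [h0] with u hu hmem
  rw [uIoc_of_le (by linarith)] at hmem
  have : Int.fract u = u - n := by
    rw [Int.fract, Int.floor_eq_iff.2 ⟨hmem.1.le, lt_of_le_of_ne hmem.2 hu⟩]
  rw [this]

theorem integral_cell_parts {β β' : ℝ → ℝ} (hβ : ∀ x, HasDerivAt β (β' x) x) (hβ' : Continuous β')
    {f f' : ℝ → ℂ} (hf : ∀ x, HasDerivAt f (f' x) x) (hf' : Continuous f') (n : ℤ) :
    ∫ u in (n : ℝ)..n + 1, (β (Int.fract u) : ℂ) * f' u =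
      β 1 * f (n + 1 : ℤ) - β 0 * f n - ∫ u in (n : ℝ)..n + 1, (β' (Int.fract u) : ℂ) * f u := by
  rw [integral_fract_cell, integral_fract_cell]
  have h := intervalIntegral.integral_mul_deriv_eq_deriv_mul (a := (n : ℝ)) (b := n + 1)
    (u := fun u => (β (u - n) : ℂ)) (u' := fun u => (β' (u - n) : ℂ)) (v := f) (v' := f')
    (fun x _ => ((hβ (x - n)).comp_sub_const x n).ofReal_comp) (fun x _ => hf x)
    (by apply Continuous.intervalIntegrable; fun_prop) (hf'.intervalIntegrable _ _)
  rw [h]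
  simp

theorem hasSum_int_of_integrable_deriv {f f' : ℝ → ℂ} (hf : ∀ x, HasDerivAt f (f' x) x)
    (hf' : Continuous f') (hi : Integrable f) (hi' : Integrable f') :
    HasSum (fun n : ℤ => f n) ((∫ u, f u) + ∫ u, (bernoulliKernel 1 u : ℂ) * f' u) ∧
      ∫ u, f' u = 0 := by
  have hc : Continuous f := continuous_iff_continuousAt.2 fun x => (hf x).continuousAt
  have hb := integrable_bernoulliKernel_mul 1 hi'
  have e1 : ∀ n : ℤ, ∫ u in (n : ℝ)..n + 1, f' u = f (n + 1 : ℤ) - f n := fun n => by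
    rw [intervalIntegral.integral_eq_sub_of_hasDerivAt (fun x _ => hf x)
      (hf'.intervalIntegrable _ _)]
    simp
  have e2 : ∀ n : ℤ, ∫ u in (n : ℝ)..n + 1, (bernoulliKernel 1 u : ℂ) * f' u =
      (1 / 2 : ℝ) * f (n + 1 : ℤ) + (1 / 2 : ℝ) * f n - ∫ u in (n : ℝ)..n + 1, f u := fun n => by
    have := integral_cell_parts (β := fun x => bernoulliFun 1 x / 1 !) (β' := fun _ => 1)
      (fun x => ((hasDerivAt_bernoulliFun 1 x).div_const (1 ! : ℝ)).congr_deriv (by simp))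
      continuous_const hf hf' n
    rw [show (fun u => (bernoulliKernel 1 u : ℂ) * f' u) = fun u =>
      ((bernoulliFun 1 (Int.fract u) / 1 ! : ℝ) : ℂ) * f' u from rfl, this,
      show bernoulliFun 1 1 / 1 ! = (1 / 2 : ℝ) by simp; norm_num,
      show bernoulliFun 1 0 / 1 ! = (-(1 / 2) : ℝ) by simp [bernoulliFun_one]]
    simp only [Complex.ofReal_one, one_mul, Complex.ofReal_neg, neg_mul, sub_neg_eq_add]
  have s0 := hi.hasSum_intervalIntegral 0
  have s1 := hi'.hasSum_intervalIntegral 0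
  have s2 := hb.hasSum_intervalIntegral 0
  simp only [zero_add] at s0 s1 s2
  have key := (s0.add s2).sub (s1.mul_left (1 / 2 : ℂ))
  have hs : HasSum (fun n : ℤ => f n) ((∫ u, f u) + (∫ u, (bernoulliKernel 1 u : ℂ) * f' u)
      - (1 / 2) * ∫ u, f' u) := by
    refine key.congr_fun fun n => ?_
    rw [e1, e2]
    push_cast
    ring
  have hz : ∫ u, f' u = 0 := by
    have hshift : HasSum (fun n : ℤ => f (n + 1 : ℤ)) _ :=
      (Equiv.addRight (1 : ℤ)).hasSum_iff.2 hs
    have := hshift.sub hs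
    rw [sub_self] at this
    refine s1.unique (this.congr_fun fun n => ?_)
    rw [e1]
  refine ⟨?_, hz⟩
  rwa [hz, mul_zero, sub_zero] at hs

theorem integral_bernoulliKernel_succ {f f' : ℝ → ℂ} (hf : ∀ x, HasDerivAt f (f' x) x)
    (hf' : Continuous f') (hi : Integrable f) (hi' : Integrable f') (k : ℕ) :
    ∫ u, (bernoulliKernel (k + 2) u : ℂ) * f' u = - ∫ u, (bernoulliKernel (k + 1) u : ℂ) * f u := by
  have hz := (hasSum_int_of_integrable_deriv hf hf' hi hi').2
  have s0 := (integrable_bernoulliKernel_mul (k + 1) hi).hasSum_intervalIntegral 0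
  have s1 := hi'.hasSum_intervalIntegral 0
  have s2 := (integrable_bernoulliKernel_mul (k + 2) hi').hasSum_intervalIntegral 0
  simp only [zero_add] at s0 s1 s2
  have e1 : ∀ n : ℤ, ∫ u in (n : ℝ)..n + 1, f' u = f (n + 1 : ℤ) - f n := fun n => by
    rw [intervalIntegral.integral_eq_sub_of_hasDerivAt (fun x _ => hf x)
      (hf'.intervalIntegrable _ _)]
    simp
  have e2 : ∀ n : ℤ, ∫ u in (n : ℝ)..n + 1, (bernoulliKernel (k + 2) u : ℂ) * f' u =
      (bernoulliFun (k + 2) 0 / (k + 2)! : ℝ) * (f (n + 1 : ℤ) - f n) -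
        ∫ u in (n : ℝ)..n + 1, (bernoulliKernel (k + 1) u : ℂ) * f u := fun n => by
    have := integral_cell_parts (β := fun x => bernoulliFun (k + 2) x / (k + 2)!)
      (β' := fun x => bernoulliFun (k + 1) x / (k + 1)!)
      (fun x => by
        have := (hasDerivAt_bernoulliFun (k + 2) x).div_const ((k + 2)! : ℝ)
        refine this.congr_deriv ?_
        have h1 : ((k + 2)! : ℝ) = (k + 2) * (k + 1)! := by
          rw [Nat.factorial_succ]; push_cast; ring
        have h2 : ((k + 1)! : ℝ) ≠ 0 := by positivity
        have h3 : (k + 2 : ℝ) ≠ 0 := by positivity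
        rw [h1]
        simp only [Nat.add_succ_sub_one]
        push_cast
        field_simp) ((continuous_bernoulliFun _).div_const _) hf hf' n
    rw [show (fun u => (bernoulliKernel (k + 2) u : ℂ) * f' u) = fun u =>
      ((bernoulliFun (k + 2) (Int.fract u) / (k + 2)! : ℝ) : ℂ) * f' u from rfl, this,
      bernoulliFun_endpoints_eq_of_ne_one (by omega), ← mul_sub]
    rfl
  have key := (s1.mul_left ((bernoulliFun (k + 2) 0 / (k + 2)! : ℝ) : ℂ)).sub s0
  rw [hz, mul_zero, zero_sub] at key
  refine s2.unique (key.congr_fun fun n => ?_)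
  rw [e2, e1]

/-- Euler–Maclaurin summation over `ℤ`. -/
theorem hasSum_euler_maclaurin {f : ℕ → ℝ → ℂ} (hf : ∀ k x, HasDerivAt (f k) (f (k + 1) x) x)
    (hi : ∀ k, Integrable (f k)) (K : ℕ) :
    HasSum (fun n : ℤ => f 0 n)
      ((∫ u, f 0 u) + (-1) ^ K * ∫ u, (bernoulliKernel (K + 1) u : ℂ) * f (K + 1) u) := by
  have hc : ∀ k, Continuous (f k) := fun k =>
    continuous_iff_continuousAt.2 fun x => (hf k x).continuousAt
  induction K with
  | zero => simpa using (hasSum_int_of_integrable_deriv (hf 0) (hc 1) (hi 0) (hi 1)).1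
  | succ K ih =>
    rw [integral_bernoulliKernel_succ (hf (K + 1)) (hc _) (hi _) (hi _) K]
    convert ih using 2
    ring

/-- Euler–Maclaurin summation over `ℤ / y`. -/
theorem hasSum_euler_maclaurin_scaled {f : ℕ → ℝ → ℂ}
    (hf : ∀ k x, HasDerivAt (f k) (f (k + 1) x) x)
    (hi : ∀ k, Integrable (f k)) (K : ℕ) {y : ℝ} (hy : 0 < y) :
    HasSum (fun n : ℤ => f 0 (n / y))
      (y * (∫ u, f 0 u) + (-1) ^ K * (y : ℂ) ^ (-(K : ℤ)) *
        ∫ t, (bernoulliKernel (K + 1) (y * t) : ℂ) * f (K + 1) t) := by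
  have hy' : (y : ℂ) ≠ 0 := by exact_mod_cast hy.ne'
  have h := hasSum_euler_maclaurin (f := fun k u => (y : ℂ) ^ (-(k : ℤ)) * f k (u / y))
    (fun k x => by
      have h1 := ((hf k (x / y)).scomp x ((hasDerivAt_id x).div_const y)).const_mul
        ((y : ℂ) ^ (-(k : ℤ)))
      refine h1.congr_deriv ?_
      rw [show (-((k + 1 : ℕ) : ℤ)) = -(k : ℤ) - 1 by push_cast; ring, zpow_sub_one₀ hy']
      simp only [Complex.real_smul]
      push_cast
      ring)
    (fun k => ((hi k).comp_div hy.ne').const_mul _) K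
  have i1 : ∫ u : ℝ, f 0 (u / y) = y * ∫ u, f 0 u := by
    rw [Measure.integral_comp_div]
    simp [abs_of_pos hy]
  have i2 : ∫ u : ℝ, (bernoulliKernel (K + 1) u : ℂ) * ((y : ℂ) ^ (-((K + 1 : ℕ) : ℤ)) *
      f (K + 1) (u / y)) =
      (y : ℂ) ^ (-(K : ℤ)) * ∫ t, (bernoulliKernel (K + 1) (y * t) : ℂ) * f (K + 1) t := by
    have := Measure.integral_comp_div (fun t : ℝ =>
      (bernoulliKernel (K + 1) (y * t) : ℂ) * ((y : ℂ) ^ (-((K + 1 : ℕ) : ℤ)) * f (K + 1) t)) y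
    rw [abs_of_pos hy] at this
    simp only [mul_div_cancel₀ _ hy.ne'] at this
    rw [this, ← integral_const_mul, ← integral_smul]
    refine integral_congr_ae (Eventually.of_forall fun t => ?_)
    simp only [Complex.real_smul]
    rw [show (-((K + 1 : ℕ) : ℤ)) = -(K : ℤ) - 1 by push_cast; ring, zpow_sub_one₀ hy']
    field_simp
  simp only [CharP.cast_eq_zero, neg_zero, zpow_zero, one_mul] at h
  rw [i1, i2, ← mul_assoc] at h
  exact h
end
section
open MeasureTheory Filter Topology Set
open scoped Nat Real

/-! ### The binomial series with complex exponent -/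

/-- The generalized binomial coefficient `z (z - 1) ⋯ (z - m + 1) / m!`. -/
noncomputable def cbinom (z : ℂ) (m : ℕ) : ℂ := ∏ j ∈ Finset.range m, (z - j) / (j + 1)

theorem cbinom_eq_choose (z : ℂ) (m : ℕ) : cbinom z m = Ring.choose z m := by
  rw [Ring.choose_eq_smul]
  induction m with
  | zero => simp [cbinom]
  | succ m ih =>
    rw [cbinom, Finset.prod_range_succ, ← cbinom, ih, descPochhammer_succ_right,
      Polynomial.smeval_mul, Nat.factorial_succ]
    have : (Polynomial.X - (m : Polynomial ℤ)).smeval z = z - m := by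
      simp [Polynomial.smeval_sub, Polynomial.smeval_natCast]
    rw [this, smul_eq_mul, smul_eq_mul]
    have h1 : (m ! : ℂ) ≠ 0 := by exact_mod_cast m.factorial_ne_zero
    have h2 : (m : ℂ) + 1 ≠ 0 := Nat.cast_add_one_ne_zero m
    push_cast
    field_simp

theorem differentiable_cbinom (m : ℕ) : Differentiable ℂ fun z => cbinom z m := by
  unfold cbinom
  exact Differentiable.fun_finsetProd fun j _ => by fun_prop

/-- A majorant for `‖cbinom z m‖`, `‖z‖ ≤ R`. -/
noncomputable def cbinomBound (R : ℝ) (m : ℕ) : ℝ := ∏ j ∈ Finset.range m, (R + j) / (j + 1)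

theorem norm_cbinom_le {z : ℂ} {R : ℝ} (hz : ‖z‖ ≤ R) (m : ℕ) : ‖cbinom z m‖ ≤ cbinomBound R m := by
  rw [cbinom, norm_prod, cbinomBound]
  refine Finset.prod_le_prod (fun _ _ => norm_nonneg _) fun j _ => ?_
  rw [norm_div, ← Nat.cast_add_one, Complex.norm_natCast, Nat.cast_add_one]
  gcongr
  exact (norm_sub_le _ _).trans (by simpa using hz)

theorem cbinomBound_pos {R : ℝ} (hR : 0 < R) (m : ℕ) : 0 < cbinomBound R m :=
  Finset.prod_pos fun j _ => by positivity

theorem summable_cbinomBound_mul_pow {R r : ℝ} (hR : 0 < R) (hr : 0 < r) (hr1 : r < 1) :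
    Summable fun m : ℕ => cbinomBound R m * r ^ m := by
  refine summable_of_ratio_test_tendsto_lt_one hr1
    (Eventually.of_forall fun m => (mul_pos (cbinomBound_pos hR m) (pow_pos hr m)).ne') ?_
  have h1 : Tendsto (fun m : ℕ => (R - 1) * (1 / ((m : ℝ) + 1))) atTop (𝓝 ((R - 1) * 0)) :=
    tendsto_one_div_add_atTop_nhds_zero_nat.const_mul _
  have h2 := (h1.const_add 1).mul_const r
  simp only [mul_zero, add_zero, one_mul] at h2
  refine h2.congr fun m => ?_
  have hb := (cbinomBound_pos hR m).ne'
  rw [Real.norm_of_nonneg (mul_pos (cbinomBound_pos hR _) (pow_pos hr _)).le,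
    Real.norm_of_nonneg (mul_pos (cbinomBound_pos hR _) (pow_pos hr _)).le,
    cbinomBound, Finset.prod_range_succ, ← cbinomBound]
  have : (m : ℝ) + 1 ≠ 0 := by positivity
  field_simp
  ring

theorem hasSum_cbinom (z : ℂ) {x : ℂ} (hx : ‖x‖ < 1) :
    HasSum (fun m => cbinom z m * x ^ m) ((1 + x) ^ z) := by
  have h := (Complex.one_add_cpow_hasFPowerSeriesOnBall_zero (a := z)).hasSum (y := x) (by
    simpa [← ofReal_norm, ENNReal.ofReal_lt_one] using hx)
  simp only [zero_add] at h
  refine h.congr_fun fun m => ?_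
  rw [binomialSeries_apply, cbinom_eq_choose]
  simp

theorem hasSum_cbinom_even (z : ℂ) {x : ℂ} (hx : ‖x‖ < 1) :
    HasSum (fun k => cbinom z (2 * k) * x ^ (2 * k)) (((1 + x) ^ z + (1 - x) ^ z) / 2) := by
  have h := ((hasSum_cbinom z hx).add (hasSum_cbinom z (x := -x) (by simpa using hx))).div_const 2
  rw [← sub_eq_add_neg] at h
  have hinj : Function.Injective fun k : ℕ => 2 * k := mul_right_injective₀ two_ne_zero
  rw [← hinj.hasSum_iff] at h
  · refine h.congr_fun fun k => ?_
    simp [pow_mul]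
  · intro m hm
    have : Odd m := by
      rw [← Nat.not_even_iff_odd]
      rintro ⟨k, rfl⟩
      exact hm ⟨k, by ring⟩
    simp [this.neg_pow]

/-! ### Expansion of the periodic zeta function at the origin -/

theorem exists_bound_riemannZeta : ∃ Z : ℝ, 0 ≤ Z ∧ ∀ s : ℂ, 2 ≤ s.re → ‖riemannZeta s‖ ≤ Z := by
  have hsum : Summable fun n : ℕ => 1 / ((n : ℝ) + 1) ^ 2 := by
    exact_mod_cast (summable_nat_add_iff 1).2 (Real.summable_one_div_nat_pow.2 one_lt_two)
  refine ⟨∑' n : ℕ, 1 / ((n : ℝ) + 1) ^ 2, tsum_nonneg fun _ => by positivity, fun s hs => ?_⟩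
  rw [zeta_eq_tsum_one_div_nat_add_one_cpow (by linarith)]
  refine tsum_of_norm_bounded hsum.hasSum fun n => ?_
  rw [norm_div, norm_one, ← Nat.cast_add_one, norm_natCast_cpow_of_pos n.succ_pos]
  have h1 : (1 : ℝ) ≤ ((n + 1 : ℕ) : ℝ) := by simp
  have := Real.rpow_le_rpow_of_exponent_le h1 hs
  rw [Real.rpow_two] at this
  push_cast at this ⊢
  gcongr

/-- The regular part of the expansion of the periodic zeta function at the origin. -/
noncomputable def zetaTail (p : ℂ × ℂ) : ℂ :=
  ∑' k : ℕ, cbinom (p.2 - 1) (2 * (k + 1)) * riemannZeta (1 - p.2 + 2 * (k + 1 : ℕ)) *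
    p.1 ^ (2 * (k + 1))

/-- The complement of `{2, 3, 4, …}`. -/
def regularW : Set ℂ := {w | ∀ n : ℕ, w ≠ n + 2}

theorem isOpen_regularW : IsOpen regularW := by
  have h : regularW = ((fun n : ℤ => ((n : ℝ) : ℂ)) '' Ici 2)ᶜ := by
    ext w
    simp only [regularW, mem_ofPred_eq, mem_compl_iff, mem_image, mem_Ici, not_exists, not_and]
    refine ⟨fun hw n hn h => hw (n - 2).toNat ?_, fun hw n h => hw (n + 2) (by omega) ?_⟩
    · rw [← h]
      have : (((n - 2).toNat : ℤ) : ℂ) = ((n - 2 : ℤ) : ℂ) := by rw [Int.toNat_of_nonneg (by omega)]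
      rw [Int.cast_natCast] at this
      rw [this]
      push_cast
      ring
    · rw [h]
      push_cast
      ring
  rw [h, isOpen_compl_iff]
  exact (Complex.isometry_ofReal.isClosedEmbedding.comp
    Int.isClosedEmbedding_coe_real).isClosedMap _
    (isClosed_discrete _)

theorem isPreconnected_regularW : IsPreconnected regularW := by
  have h : regularW = (range fun n : ℕ => (n : ℂ) + 2)ᶜ := by
    ext w
    simp [regularW, eq_comm]
  rw [h]
  exact ((countable_range _).isPathConnected_compl_of_one_lt_rank
    (by rw [Complex.rank_real_complex]; norm_num)).isConnected.isPreconnected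

theorem differentiableAt_zetaTail_term {p : ℂ × ℂ} (hp : p.2 ∈ regularW) (k : ℕ) :
    DifferentiableAt ℂ (fun q : ℂ × ℂ => cbinom (q.2 - 1) (2 * (k + 1)) *
      riemannZeta (1 - q.2 + 2 * (k + 1 : ℕ)) * q.1 ^ (2 * (k + 1))) p := by
  have h1 : DifferentiableAt ℂ (fun q : ℂ × ℂ => cbinom (q.2 - 1) (2 * (k + 1))) p :=
    (differentiable_cbinom _ _).comp p (by fun_prop)
  have hne : 1 - p.2 + 2 * (k + 1 : ℕ) ≠ 1 := fun h => hp (2 * k) (by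
    push_cast at h ⊢
    linear_combination -h)
  have h2 : DifferentiableAt ℂ (fun q : ℂ × ℂ => riemannZeta (1 - q.2 + 2 * (k + 1 : ℕ))) p :=
    DifferentiableAt.comp p (g := riemannZeta) (differentiableAt_riemannZeta hne) (by fun_prop)
  exact (h1.mul h2).mul (by fun_prop)

theorem exists_bound_zetaTail_term {p : ℂ × ℂ} (hp1 : ‖p.1‖ < 1) (hp2 : p.2 ∈ regularW) :
    ∃ V ∈ 𝓝 p, ∃ b : ℕ → ℝ, Summable b ∧ ∀ k : ℕ, ∀ q ∈ V,
      ‖cbinom (q.2 - 1) (2 * (k + 1)) * riemannZeta (1 - q.2 + 2 * (k + 1 : ℕ)) *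
        q.1 ^ (2 * (k + 1))‖ ≤ b k := by
  set T : ℕ → ℂ × ℂ → ℂ := fun k q => cbinom (q.2 - 1) (2 * (k + 1)) *
    riemannZeta (1 - q.2 + 2 * (k + 1 : ℕ)) * q.1 ^ (2 * (k + 1)) with hT
  obtain ⟨Z, hZ0, hZ⟩ := exists_bound_riemannZeta
  obtain ⟨r, hr, hr1⟩ := exists_between hp1
  have hr0 : 0 < r := (norm_nonneg _).trans_lt hr
  set R : ℝ := ‖p.2‖ + 2 with hR
  have hR0 : 0 < R := by positivity
  obtain ⟨N, hN⟩ := exists_nat_ge R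
  have hV1 : ∀ᶠ q : ℂ × ℂ in 𝓝 p, ‖q.1‖ < r :=
    (continuous_fst.norm.tendsto p).eventually (gt_mem_nhds hr)
  have hV2 : ∀ᶠ q : ℂ × ℂ in 𝓝 p, ‖q.2‖ < ‖p.2‖ + 1 :=
    (continuous_snd.norm.tendsto p).eventually (gt_mem_nhds (by linarith))
  have hV3 : ∀ᶠ q : ℂ × ℂ in 𝓝 p, ∀ k ∈ Finset.range N, ‖T k q‖ < ‖T k p‖ + 1 := by
    rw [Filter.eventually_all_finset]
    intro k _
    exact (differentiableAt_zetaTail_term hp2 k).continuousAt.norm.eventually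
      (gt_mem_nhds (lt_add_one _))
  refine ⟨_, hV1.and (hV2.and hV3), fun k => if k < N then ‖T k p‖ + 1 else
    cbinomBound R (2 * (k + 1)) * r ^ (2 * (k + 1)) * Z, ?_, ?_⟩
  · rw [← summable_nat_add_iff N]
    have hinj : Function.Injective fun k : ℕ => 2 * (k + N + 1) := fun a b h => by
      simp only at h
      omega
    refine (((summable_cbinomBound_mul_pow hR0 hr0 hr1).comp_injective hinj).mul_right Z).congr
      fun k => ?_
    simp
  · rintro k q ⟨h1, h2, h3⟩
    change ‖T k q‖ ≤ ite _ _ _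
    split_ifs with hk
    · exact (h3 k (Finset.mem_range.2 hk)).le
    · rw [hT]
      simp only
      rw [norm_mul, norm_mul, norm_pow, mul_right_comm]
      have hb : ‖cbinom (q.2 - 1) (2 * (k + 1))‖ ≤ cbinomBound R (2 * (k + 1)) :=
        norm_cbinom_le ((norm_sub_le _ _).trans (by rw [norm_one]; linarith)) _
      have hz : ‖riemannZeta (1 - q.2 + 2 * (k + 1 : ℕ))‖ ≤ Z := by
        apply hZ
        have h4 : q.2.re ≤ ‖q.2‖ := (le_abs_self _).trans (Complex.abs_re_le_norm _)
        have h5 : (N : ℝ) ≤ k := by exact_mod_cast not_lt.1 hk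
        simp
        linarith
      have := (cbinomBound_pos hR0 (2 * (k + 1))).le
      gcongr

theorem differentiableOn_zetaTail :
    DifferentiableOn ℂ zetaTail (Metric.ball 0 1 ×ˢ regularW) := by
  have hopen : IsOpen (Metric.ball (0 : ℂ) 1 ×ˢ regularW) :=
    Metric.isOpen_ball.prod isOpen_regularW
  refine differentiableOn_tsum_of_dominated hopen (fun k p hp =>
    (differentiableAt_zetaTail_term hp.2 k).differentiableWithinAt) fun p hp => ?_
  obtain ⟨V, hV, b, hb, h⟩ := exists_bound_zetaTail_term (by simpa using hp.1) hp.2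
  exact ⟨V, hV, b, hb, h⟩

theorem hurwitzZetaEven_eq_add_zetaTail {a : ℝ} (ha0 : 0 < a) (ha1 : a < 1) {s : ℂ}
    (hs : 1 < s.re) :
    HurwitzZeta.hurwitzZetaEven (a : UnitAddCircle) s =
      (a : ℂ) ^ (-s) / 2 + riemannZeta s + zetaTail (a, 1 - s) := by
  have hs0 : s ≠ 0 := ne_zero_of_one_lt_re hs
  have h1 := (HurwitzZeta.hasSum_int_hurwitzZetaEven a hs).nat_add_neg
  rw [← hasSum_nat_add_iff' 1] at h1
  simp only [Finset.range_one, Finset.sum_singleton] at h1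
  set T : ℕ → ℕ → ℂ := fun n k =>
    ((n : ℂ) + 1) ^ (-s) * (cbinom (-s) (2 * k) * (a / (n + 1)) ^ (2 * k)) with hT
  have hx : ∀ n : ℕ, a / ((n : ℝ) + 1) < 1 := fun n => by
    rw [div_lt_one (by positivity)]
    linarith [n.cast_nonneg (α := ℝ)]
  have hxn : ∀ n : ℕ, ‖((a / ((n : ℝ) + 1) : ℝ) : ℂ)‖ ≤ a := fun n => by
    rw [Complex.norm_real, Real.norm_of_nonneg (by positivity)]
    exact div_le_self ha0.le (by linarith [n.cast_nonneg (α := ℝ)])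
  have hfac : ∀ (n : ℕ) (y : ℝ), 0 ≤ y →
      1 / ((((n : ℝ) + 1) * y : ℝ) : ℂ) ^ s = ((n : ℂ) + 1) ^ (-s) * (y : ℂ) ^ (-s) := by
    intro n y hy
    rw [Complex.ofReal_mul, Complex.mul_cpow_ofReal_nonneg (by positivity) hy, Complex.cpow_neg,
      Complex.cpow_neg]
    push_cast
    rw [one_div, mul_inv]
  have hrow : ∀ n : ℕ, HasSum (T n) (1 / ((|(((n + 1 : ℕ) : ℤ) : ℝ) + a| : ℝ) : ℂ) ^ s / 2 +
      1 / ((|((-((n + 1 : ℕ) : ℤ) : ℤ) : ℝ) + a| : ℝ) : ℂ) ^ s / 2) := by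
    intro n
    have hn : (n : ℝ) + 1 ≠ 0 := by positivity
    have e1 : |(((n + 1 : ℕ) : ℤ) : ℝ) + a| = ((n : ℝ) + 1) * (1 + a / (n + 1)) := by
      rw [abs_of_nonneg (by positivity)]
      push_cast
      field_simp
    have e2 : |((-((n + 1 : ℕ) : ℤ) : ℤ) : ℝ) + a| = ((n : ℝ) + 1) * (1 - a / (n + 1)) := by
      rw [abs_of_nonpos (by push_cast; linarith [n.cast_nonneg (α := ℝ)])]
      push_cast
      field_simp
      ring
    have hsum := (hasSum_cbinom_even (-s) (x := ((a / ((n : ℝ) + 1) : ℝ) : ℂ))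
      ((hxn n).trans_lt ha1)).mul_left (((n : ℂ) + 1) ^ (-s))
    have h0 : 0 ≤ a / ((n : ℝ) + 1) := by positivity
    rw [e1, e2, hfac n _ (by linarith), hfac n _ (by linarith [hx n]), ← add_div, ← mul_add,
      mul_div_assoc]
    refine HasSum.congr_fun (by simpa using hsum) fun k => ?_
    simp [hT]
  have hsummable : Summable (Function.uncurry T) := by
    have hz : Summable fun n : ℕ => ‖((n : ℂ) + 1) ^ (-s)‖ := by
      have := ((summable_nat_add_iff 1).2 (Complex.summable_one_div_nat_cpow.2 hs)).norm
      refine this.congr fun n => ?_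
      rw [Complex.cpow_neg]
      push_cast
      rw [one_div]
    have hR0 : 0 < ‖s‖ := norm_pos_iff.2 hs0
    have hb := (summable_cbinomBound_mul_pow hR0 ha0 ha1).comp_injective
      (mul_right_injective₀ two_ne_zero)
    refine Summable.of_norm_bounded (hz.mul_of_nonneg hb (fun _ => norm_nonneg _)
      (fun k => (mul_pos (cbinomBound_pos hR0 _) (pow_pos ha0 _)).le)) fun x => ?_
    simp only [Function.uncurry, hT, norm_mul, norm_pow, Function.comp]
    have h1 := norm_cbinom_le (z := -s) (norm_neg s).le (2 * x.2)
    have h2 := hxn x.1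
    push_cast at h2
    have := (cbinomBound_pos hR0 (2 * x.2)).le
    gcongr
  have hcol : ∀ k : ℕ, ∑' n : ℕ, T n k =
      cbinom (-s) (2 * k) * riemannZeta (s + 2 * k) * (a : ℂ) ^ (2 * k) := by
    intro k
    have hre : 1 < (s + 2 * k).re := by
      simp
      linarith [k.cast_nonneg (α := ℝ)]
    rw [zeta_eq_tsum_one_div_nat_add_one_cpow hre, mul_assoc, ← tsum_mul_right, ← tsum_mul_left]
    refine tsum_congr fun n => ?_
    have hn : (n : ℂ) + 1 ≠ 0 := Nat.cast_add_one_ne_zero n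
    have : ((n : ℂ) + 1) ^ (s + 2 * k) = ((n : ℂ) + 1) ^ s * ((n : ℂ) + 1) ^ (2 * k) := by
      rw [Complex.cpow_add _ _ hn]
      congr 1
      exact_mod_cast Complex.cpow_natCast ((n : ℂ) + 1) (2 * k)
    simp only [hT]
    rw [this, Complex.cpow_neg, div_pow]
    have := pow_ne_zero (2 * k) hn
    field_simp
  have htotal : ∑' n : ℕ, ∑' k : ℕ, T n k = riemannZeta s + zetaTail (a, 1 - s) := by
    have hcomm := hsummable.tsum_comm
    rw [← hcomm]
    have hs2 : Summable fun k => ∑' n : ℕ, T n k := by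
      simpa [Function.uncurry] using hsummable.prod_symm.prod
    rw [hs2.tsum_eq_zero_add]
    simp only [hcol]
    congr 1
    · simp [cbinom]
    · unfold zetaTail
      refine tsum_congr fun k => ?_
      simp only
      congr 3
      · ring
      · push_cast; ring
  have hT2 := tsum_congr (L := SummationFilter.unconditional ℕ) fun n => (hrow n).tsum_eq
  rw [htotal] at hT2
  have h2 := h1.tsum_eq
  rw [← hT2] at h2
  have h0 : 1 / ((|((0 : ℤ) : ℝ) + a| : ℝ) : ℂ) ^ s = (a : ℂ) ^ (-s) := by
    rw [Int.cast_zero, zero_add, abs_of_pos ha0, Complex.cpow_neg, one_div]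
  simp only [Nat.cast_zero, neg_zero] at h2
  rw [h0] at h2
  linear_combination -h2

/-- `(w - 1)` times the gamma factor of the functional equation of the periodic zeta function. -/
noncomputable def gammaFactor (w : ℂ) : ℂ :=
  -(2 * (2 * π) ^ (w - 1) * Gamma (2 - w) * cos (π * (1 - w) / 2))

theorem differentiableOn_gammaFactor : DifferentiableOn ℂ gammaFactor regularW := by
  intro w hw
  have h1 : DifferentiableAt ℂ (fun w : ℂ => Gamma (2 - w)) w := by
    refine DifferentiableAt.comp w (g := Gamma) (differentiableAt_Gamma _ fun n h => hw n ?_)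
      (by fun_prop)
    linear_combination -h
  have h2 : DifferentiableAt ℂ (fun w : ℂ => (2 * π : ℂ) ^ (w - 1)) w := by
    refine DifferentiableAt.const_cpow (by fun_prop) (Or.inl ?_)
    exact mul_ne_zero two_ne_zero (by exact_mod_cast Real.pi_ne_zero)
  unfold gammaFactor
  exact ((((h2.const_mul 2).mul h1).mul (by fun_prop)).neg).differentiableWithinAt

theorem sub_one_mul_cosZeta_of_re_neg {a : ℝ} (ha0 : 0 < a) (ha1 : a < 1) {w : ℂ} (hw : w.re < 0) :
    (w - 1) * HurwitzZeta.cosZeta (a : UnitAddCircle) w =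
      riemannZeta₁ w + gammaFactor w * ((a : ℂ) ^ (w - 1) / 2 + zetaTail (a, w)) := by
  have hs : 1 < (1 - w).re := by simp; linarith
  have hw1 : w ≠ 1 := fun h => by rw [h, one_re] at hw; linarith
  have h1 := HurwitzZeta.cosZeta_one_sub (a : UnitAddCircle) (s := 1 - w) (fun n h => by
    have := congrArg re h
    simp at this
    linarith [n.cast_nonneg (α := ℝ)])
  have h2 := riemannZeta_one_sub (s := 1 - w) (fun n h => by
    have := congrArg re h
    simp at this
    linarith [n.cast_nonneg (α := ℝ)]) (fun h => by
    have := congrArg re h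
    simp at this
    linarith)
  have h3 : Gamma (2 - w) = (1 - w) * Gamma (1 - w) := by
    rw [← Gamma_add_one _ (sub_ne_zero.2 hw1.symm)]
    ring_nf
  have h4 := riemannZeta_eq_inv_sub_mul hw1
  rw [sub_sub_cancel] at h1 h2
  have h5 : riemannZeta₁ w = (w - 1) * riemannZeta w := by
    rw [h4, mul_inv_cancel_left₀ (sub_ne_zero.2 hw1)]
  rw [h5, h1, h2, hurwitzZetaEven_eq_add_zetaTail ha0 ha1 hs, gammaFactor, h3, sub_sub_cancel,
    neg_sub]
  ring

/-- Expansion of the periodic zeta function at the origin. -/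
theorem sub_one_mul_cosZeta {a : ℝ} (ha0 : 0 < a) (ha1 : a < 1) {w : ℂ} (hw : w ∈ regularW) :
    (w - 1) * HurwitzZeta.cosZeta (a : UnitAddCircle) w =
      riemannZeta₁ w + gammaFactor w * ((a : ℂ) ^ (w - 1) / 2 + zetaTail (a, w)) := by
  have ha : (a : UnitAddCircle) ≠ 0 := by
    rw [Ne, AddCircle.coe_eq_zero_iff]
    rintro ⟨n, hn⟩
    rw [zsmul_one] at hn
    have h1 : (0 : ℝ) < n := by rwa [hn]
    have h2 : (n : ℝ) < 1 := by rwa [hn]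
    have h3 : 0 < n := by exact_mod_cast h1
    have h4 : n < 1 := by exact_mod_cast h2
    omega
  have hL : AnalyticOnNhd ℂ (fun w => (w - 1) * HurwitzZeta.cosZeta (a : UnitAddCircle) w)
      regularW := by
    refine DifferentiableOn.analyticOnNhd (Differentiable.differentiableOn ?_) isOpen_regularW
    exact (by fun_prop : Differentiable ℂ fun w : ℂ => w - 1).mul
      (HurwitzZeta.differentiable_cosZeta_of_ne_zero ha)
  have hR : AnalyticOnNhd ℂ (fun w => riemannZeta₁ w + gammaFactor w *
      ((a : ℂ) ^ (w - 1) / 2 + zetaTail (a, w))) regularW := by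
    refine DifferentiableOn.analyticOnNhd ?_ isOpen_regularW
    have h1 : Differentiable ℂ fun w : ℂ => (a : ℂ) ^ (w - 1) := fun w =>
      DifferentiableAt.const_cpow (by fun_prop) (Or.inl (by exact_mod_cast ha0.ne'))
    have h2 : DifferentiableOn ℂ (fun w => zetaTail (a, w)) regularW :=
      differentiableOn_zetaTail.comp (by fun_prop) fun w hw =>
        ⟨by simpa [abs_of_pos ha0] using ha1, hw⟩
    exact differentiable_riemannZeta₁.differentiableOn.add
      (differentiableOn_gammaFactor.mul ((h1.differentiableOn.div_const 2).add h2))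
  have hmem : (-1 : ℂ) ∈ regularW := fun n h => by
    have := congrArg re h
    simp at this
    linarith [n.cast_nonneg (α := ℝ)]
  refine hL.eqOn_of_preconnected_of_eventuallyEq hR isPreconnected_regularW hmem ?_ hw
  filter_upwards [(isOpen_lt continuous_re continuous_const).mem_nhds
    (show (-1 : ℂ).re < 0 by simp)] with w hw
  exact sub_one_mul_cosZeta_of_re_neg ha0 ha1 hw

end
section
open MeasureTheory Filter Topology Set
open scoped Real

/-! ### Non-zero ideals and the lattice points of a quadrant -/

/-- The Gaussian integer `(m + 1) + n i`. -/
def quadrantPoint (x : ℕ × ℕ) : GaussianInt := ⟨x.1 + 1, x.2⟩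

theorem quadrantPoint_ne_zero (x : ℕ × ℕ) : quadrantPoint x ≠ 0 := fun h => by
  have : ((x.1 : ℤ) + 1) = 0 := congrArg Zsqrtd.re h
  omega

theorem eq_of_isUnit {u : GaussianInt} (hu : IsUnit u) :
    u = 1 ∨ u = -1 ∨ u = ⟨0, 1⟩ ∨ u = ⟨0, -1⟩ := by
  have hn : u.norm = 1 := by
    have h := Zsqrtd.norm_eq_one_iff.2 hu
    have h0 : 0 ≤ u.norm := GaussianInt.norm_nonneg u
    omega
  rcases u with ⟨a, b⟩
  have hab : a * a + b * b = 1 := by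
    have : a * a - (-1) * b * b = 1 := hn
    linarith
  have ha1 : a ≤ 1 := by nlinarith
  have ha2 : -1 ≤ a := by nlinarith
  have hb1 : b ≤ 1 := by nlinarith
  have hb2 : -1 ≤ b := by nlinarith
  interval_cases a <;> interval_cases b <;> simp_all [Zsqrtd.ext_iff]

/-- The ideal generated by a lattice point of the quadrant. -/
def quadrantIdeal (x : ℕ × ℕ) : NonzeroIdeal :=
  ⟨Ideal.span {quadrantPoint x}, by
    rw [Ne, Ideal.span_singleton_eq_bot]
    exact quadrantPoint_ne_zero x⟩

theorem quadrantIdeal_bijective : Function.Bijective quadrantIdeal := by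
  constructor
  · rintro ⟨m, n⟩ ⟨m', n'⟩ h
    have h1 : Ideal.span {quadrantPoint (m, n)} = Ideal.span {quadrantPoint (m', n')} :=
      congrArg Subtype.val h
    rw [Ideal.span_singleton_eq_span_singleton] at h1
    obtain ⟨u, hu⟩ := h1
    have hre := congrArg Zsqrtd.re hu
    have him := congrArg Zsqrtd.im hu
    rw [Zsqrtd.re_mul] at hre
    rw [Zsqrtd.im_mul] at him
    rcases eq_of_isUnit u.isUnit with h | h | h | h <;>
      simp [h, quadrantPoint] at hre him ⊢ <;> omega
  · rintro ⟨I, hI⟩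
    set g := Submodule.IsPrincipal.generator I with hg
    have hspan : Ideal.span {g} = I := Ideal.span_singleton_generator I
    have hg0 : g ≠ 0 := fun h => hI (by rw [← hspan, h, Ideal.span_singleton_eq_bot])
    suffices h : ∃ (u : GaussianInt) (x : ℕ × ℕ), u * u * (u * u) = 1 ∧ g * u = quadrantPoint x by
      obtain ⟨u, x, hu, hx⟩ := h
      refine ⟨x, Subtype.ext ?_⟩
      change Ideal.span {quadrantPoint x} = I
      rw [← hx, ← hspan]
      have : IsUnit u := IsUnit.of_mul_eq_one (u * (u * u)) (by rw [← mul_assoc, hu])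
      exact Ideal.span_singleton_mul_right_unit this g
    rcases hgc : g with ⟨a, b⟩
    have hab : ¬ (a = 0 ∧ b = 0) := fun h => hg0 (by rw [hgc, h.1, h.2]; rfl)
    by_cases h1 : 0 < a ∧ 0 ≤ b
    · exact ⟨1, ((a - 1).toNat, b.toNat), by simp, by
        simp only [quadrantPoint, mul_one, Zsqrtd.ext_iff]; omega⟩
    by_cases h2 : a < 0 ∧ b ≤ 0
    · exact ⟨-1, ((-a - 1).toNat, (-b).toNat), by simp, by
        simp [quadrantPoint, Zsqrtd.ext_iff]; omega⟩
    by_cases h3 : 0 ≤ a ∧ b < 0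
    · exact ⟨⟨0, 1⟩, ((-b - 1).toNat, a.toNat), by decide, by
        simp [quadrantPoint, Zsqrtd.ext_iff]; omega⟩
    · exact ⟨⟨0, -1⟩, ((b - 1).toNat, (-a).toNat), by decide, by
        simp [quadrantPoint, Zsqrtd.ext_iff]; omega⟩

/-- Non-zero ideals correspond to the lattice points of a quadrant. -/
noncomputable def quadrantEquiv : ℕ × ℕ ≃ NonzeroIdeal :=
  Equiv.ofBijective quadrantIdeal quadrantIdeal_bijective

theorem toComplex_quadrantPoint (x : ℕ × ℕ) :
    GaussianInt.toComplex (quadrantPoint x) = ((x.1 : ℂ) + 1) + x.2 * I := by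
  simp [quadrantPoint, GaussianInt.toComplex_def]

theorem absNorm_quadrantEquiv (x : ℕ × ℕ) :
    (Ideal.absNorm (quadrantEquiv x).1 : ℂ) = (((x.1 + 1 : ℝ) ^ 2 + (x.2 : ℝ) ^ 2 : ℝ) : ℂ) := by
  have h : Ideal.absNorm (quadrantEquiv x).1 = (x.1 + 1) ^ 2 + x.2 ^ 2 := by
    change Ideal.absNorm (Ideal.span {quadrantPoint x}) = _
    rw [absNorm_span, Zsqrtd.norm_def]
    simp only [quadrantPoint]
    zify
    rw [abs_of_nonneg (by nlinarith)]
    ring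
  rw [h]
  push_cast
  ring

theorem chi_quadrantEquiv (k : ℤ) (x : ℕ × ℕ) :
    chi k (quadrantEquiv x).1 =
      cexp (2 * π * I * (2 / π * Real.arctan (x.2 / (x.1 + 1)) : ℝ) * k) := by
  change chi k (Ideal.span {quadrantPoint x}) = _
  rw [chi_span, angular, toComplex_quadrantPoint]
  set z : ℂ := ((x.1 : ℂ) + 1) + x.2 * I with hz
  have hre : z.re = x.1 + 1 := by simp [hz]
  have him : z.im = x.2 := by simp [hz]
  have hz0 : z ≠ 0 := fun h => by
    rw [h, zero_re] at hre
    linarith [x.1.cast_nonneg (α := ℝ)]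
  have harg : Complex.arg z = Real.arctan (x.2 / (x.1 + 1)) := by
    rw [Complex.arg_of_re_nonneg (by rw [hre]; positivity)]
    rw [Real.arctan_eq_arcsin]
    congr 1
    rw [Complex.norm_def, Complex.normSq_apply, hre, him]
    have h1 : (0 : ℝ) < x.1 + 1 := by positivity
    rw [show ((x.1 : ℝ) + 1) * (x.1 + 1) + (x.2 : ℝ) * x.2 =
      (x.1 + 1) ^ 2 * (1 + (x.2 / (x.1 + 1)) ^ 2) by field_simp,
      Real.sqrt_mul (by positivity), Real.sqrt_sq h1.le]
    field_simp
  have hdiv : z / (‖z‖ : ℂ) = cexp (Complex.arg z * I) := by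
    rw [div_eq_iff (by exact_mod_cast (norm_ne_zero_iff.2 hz0)), mul_comm]
    exact (Complex.norm_mul_exp_arg_mul_I z).symm
  rw [hdiv, harg, ← Complex.exp_int_mul]
  congr 1
  have : (π : ℂ) ≠ 0 := by exact_mod_cast Real.pi_ne_zero
  push_cast
  field_simp
  ring

/-! ### The double series as a sum over lattice points -/

/-- The summand of the double series at the lattice point `(x, y)`. -/
noncomputable def latticeTerm (s w : ℂ) (x y : ℝ) : ℂ :=
  ((x ^ 2 + y ^ 2 : ℝ) : ℂ) ^ (-s) *
    (1 + 2 * HurwitzZeta.cosZeta ((2 / π * Real.arctan (y / x) : ℝ) : UnitAddCircle) w)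

theorem norm_latticeNorm_le {s : ℂ} (hs : 0 ≤ s.re) (x : ℕ × ℕ) :
    ‖(((x.1 + 1 : ℝ) ^ 2 + (x.2 : ℝ) ^ 2 : ℝ) : ℂ) ^ (-s)‖ ≤
      ((x.1 : ℝ) + 1) ^ (-s.re) * ((x.2 : ℝ) + 1) ^ (-s.re) := by
  have hpos : (0 : ℝ) < (x.1 + 1) ^ 2 + (x.2 : ℝ) ^ 2 := by positivity
  rw [Complex.norm_cpow_eq_rpow_re_of_pos hpos, neg_re,
    ← Real.mul_rpow (by positivity) (by positivity)]
  refine Real.rpow_le_rpow_of_nonpos (by positivity) ?_ (by linarith)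
  rcases x with ⟨m, n⟩
  have hm : (0 : ℝ) ≤ m := m.cast_nonneg
  rcases n.eq_zero_or_pos with h | h
  · simp [h]
    nlinarith
  · have : (1 : ℝ) ≤ n := by exact_mod_cast h
    simp only
    nlinarith [sq_nonneg ((m : ℝ) + 1 - n)]

theorem summable_add_one_rpow {σ : ℝ} (hσ : 1 < σ) :
    Summable fun m : ℕ => ((m : ℝ) + 1) ^ (-σ) := by
  have := (summable_nat_add_iff 1).2 (Real.summable_nat_rpow.2 (show -σ < -1 by linarith))
  simpa using this

theorem summable_prod_rpow {σ : ℝ} (hσ : 1 < σ) :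
    Summable fun x : ℕ × ℕ => ((x.1 : ℝ) + 1) ^ (-σ) * ((x.2 : ℝ) + 1) ^ (-σ) :=
  (summable_add_one_rpow hσ).mul_of_nonneg (summable_add_one_rpow hσ)
    (fun _ => by positivity) (fun _ => by positivity)

theorem norm_chi_quadrantEquiv (k : ℤ) (x : ℕ × ℕ) : ‖chi k (quadrantEquiv x).1‖ = 1 := by
  rw [chi_quadrantEquiv]
  have : 2 * (π : ℂ) * I * (2 / π * Real.arctan (x.2 / (x.1 + 1)) : ℝ) * k =
      ((2 * π * (2 / π * Real.arctan (x.2 / (x.1 + 1))) * k : ℝ) : ℂ) * I := by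
    push_cast
    ring
  rw [this, Complex.norm_exp_ofReal_mul_I]

theorem norm_heckeTerm_le {s : ℂ} (hs : 1 < s.re) (k : ℤ) (x : ℕ × ℕ) :
    ‖chi k (quadrantEquiv x).1 * (Ideal.absNorm (quadrantEquiv x).1 : ℂ) ^ (-s)‖ ≤
      ((x.1 : ℝ) + 1) ^ (-s.re) * ((x.2 : ℝ) + 1) ^ (-s.re) := by
  rw [norm_mul, norm_chi_quadrantEquiv, one_mul, absNorm_quadrantEquiv]
  exact norm_latticeNorm_le (by linarith) x

theorem summable_heckeTerm_quadrant {s : ℂ} (hs : 1 < s.re) (k : ℤ) :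
    Summable fun x : ℕ × ℕ =>
      chi k (quadrantEquiv x).1 * (Ideal.absNorm (quadrantEquiv x).1 : ℂ) ^ (-s) :=
  (summable_prod_rpow hs).of_norm_bounded (norm_heckeTerm_le hs k)

theorem summable_heckeTerm {s : ℂ} (hs : 1 < s.re) (k : ℤ) :
    Summable fun I : NonzeroIdeal => chi k I.1 * (Ideal.absNorm I.1 : ℂ) ^ (-s) :=
  quadrantEquiv.summable_iff.1 (summable_heckeTerm_quadrant hs k)

theorem heckeL_eq (k : ℤ) (s : ℂ) : heckeL k s = ∑' x : ℕ × ℕ,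
    chi k (quadrantEquiv x).1 * (Ideal.absNorm (quadrantEquiv x).1 : ℂ) ^ (-s) :=
  (quadrantEquiv.tsum_eq fun I : NonzeroIdeal => chi k I.1 * (Ideal.absNorm I.1 : ℂ) ^ (-s)).symm

theorem norm_natAbs_cpow (n : {n : ℤ // n ≠ 0}) (w : ℂ) :
    ‖((n.1.natAbs : ℕ) : ℂ) ^ (-w)‖ = |(n.1 : ℝ)| ^ (-w.re) := by
  rw [Complex.norm_natCast_cpow_of_pos (Int.natAbs_pos.2 n.2), neg_re, Nat.cast_natAbs,
    Int.cast_abs]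

theorem summable_int_rpow {σ : ℝ} (hσ : 1 < σ) :
    Summable fun n : {n : ℤ // n ≠ 0} => |(n.1 : ℝ)| ^ (-σ) :=
  (Real.summable_abs_int_rpow hσ).comp_injective Subtype.val_injective

theorem summable_tripleTerm {s w : ℂ} (hs : 1 < s.re) (hw : 1 < w.re) :
    Summable fun z : {n : ℤ // n ≠ 0} × (ℕ × ℕ) =>
      chi z.1.1 (quadrantEquiv z.2).1 * (Ideal.absNorm (quadrantEquiv z.2).1 : ℂ) ^ (-s) *
        ((z.1.1.natAbs : ℕ) : ℂ) ^ (-w) := by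
  refine Summable.of_norm_bounded ((summable_int_rpow hw).mul_of_nonneg (summable_prod_rpow hs)
    (fun _ => by positivity) (fun _ => by positivity)) fun z => ?_
  rw [norm_mul, norm_natAbs_cpow, mul_comm]
  have := norm_heckeTerm_le hs z.1.1 z.2
  gcongr

theorem summable_doubleSeries {s w : ℂ} (hs : 1 < s.re) (hw : 1 < w.re) :
    Summable fun n : {n : ℤ // n ≠ 0} => heckeL n.1 s * ((n.1.natAbs : ℕ) : ℂ) ^ (-w) := by
  refine (summable_tripleTerm hs hw).prod.congr fun n => ?_
  rw [heckeL_eq, ← tsum_mul_right]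

theorem tsum_chi_quadrant {w : ℂ} (hw : 1 < w.re) (x : ℕ × ℕ) :
    ∑' n : {n : ℤ // n ≠ 0}, chi n.1 (quadrantEquiv x).1 * ((n.1.natAbs : ℕ) : ℂ) ^ (-w) =
      2 * HurwitzZeta.cosZeta ((2 / π * Real.arctan (x.2 / (x.1 + 1)) : ℝ) : UnitAddCircle) w := by
  have h := (HurwitzZeta.hasSum_int_cosZeta (2 / π * Real.arctan (x.2 / (x.1 + 1))) hw).mul_left 2
  rw [← h.tsum_eq]
  have hw0 : w ≠ 0 := ne_zero_of_one_lt_re hw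
  rw [← tsum_subtype_eq_of_support_subset (s := {n : ℤ | n ≠ 0})]
  · refine tsum_congr fun n => ?_
    rw [chi_quadrantEquiv, Nat.cast_natAbs, Complex.cpow_neg]
    push_cast
    field_simp
  · intro n hn h0
    simp [h0, hw0] at hn

theorem hasSum_doubleSeries {s w : ℂ} (hs : 1 < s.re) (hw : 1 < w.re) :
    HasSum (fun x : ℕ × ℕ => latticeTerm s w (x.1 + 1) x.2) (doubleSeries s w) := by
  have h0 := (summable_heckeTerm_quadrant hs 0).hasSum
  rw [← heckeL_eq] at h0
  have ht := summable_tripleTerm hs hw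
  have h1 := ht.prod_symm.hasSum.prod_fiberwise fun x => (ht.prod_symm.prod_factor x).hasSum
  have e1 : ∑' z : (ℕ × ℕ) × {n : ℤ // n ≠ 0},
      (fun z : {n : ℤ // n ≠ 0} × (ℕ × ℕ) =>
      chi z.1.1 (quadrantEquiv z.2).1 * (Ideal.absNorm (quadrantEquiv z.2).1 : ℂ) ^ (-s) *
        ((z.1.1.natAbs : ℕ) : ℂ) ^ (-w)) z.swap =
      ∑' n : {n : ℤ // n ≠ 0}, heckeL n.1 s * ((n.1.natAbs : ℕ) : ℂ) ^ (-w) := by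
    have := (Equiv.prodComm (ℕ × ℕ) {n : ℤ // n ≠ 0}).tsum_eq
      fun z : {n : ℤ // n ≠ 0} × (ℕ × ℕ) =>
      chi z.1.1 (quadrantEquiv z.2).1 * (Ideal.absNorm (quadrantEquiv z.2).1 : ℂ) ^ (-s) *
        ((z.1.1.natAbs : ℕ) : ℂ) ^ (-w)
    refine this.trans ?_
    rw [ht.tsum_prod]
    refine tsum_congr fun n => ?_
    rw [heckeL_eq, ← tsum_mul_right]
  rw [e1] at h1
  refine (h0.add h1).congr_fun fun x => ?_
  have e2 := tsum_chi_quadrant hw x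
  have e3 : chi 0 (quadrantEquiv x).1 = 1 := by rw [chi_quadrantEquiv]; simp
  simp only [latticeTerm]
  rw [← e2, e3, absNorm_quadrantEquiv, mul_add, ← tsum_mul_left]
  congr 1
  · ring
  · refine tsum_congr fun n => ?_
    simp only [Prod.swap, absNorm_quadrantEquiv]
    ring
end
section
open MeasureTheory Filter Topology Set
open scoped Real ContDiff

/-! ### Smooth families depending holomorphically on two parameters -/

/-- `f t p` is smooth in `t`, and every `t`-derivative is jointly continuous, and holomorphic in the
parameter `p ∈ Ω`. -/
def IsSmoothFamily (Ω : Set (ℂ × ℂ)) (f : ℝ → ℂ × ℂ → ℂ) : Prop :=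
  ∃ F : ℕ → ℝ → ℂ × ℂ → ℂ, (∀ p ∈ Ω, ∀ t, F 0 t p = f t p) ∧
    (∀ k, ∀ p ∈ Ω, ∀ t, HasDerivAt (fun t => F k t p) (F (k + 1) t p) t) ∧
    (∀ k, ContinuousOn (fun x : ℝ × (ℂ × ℂ) => F k x.1 x.2) (univ ×ˢ Ω)) ∧
    ∀ k t, DifferentiableOn ℂ (F k t) Ω

namespace IsSmoothFamily

variable {Ω : Set (ℂ × ℂ)} {f g : ℝ → ℂ × ℂ → ℂ}

theorem continuousOn (hf : IsSmoothFamily Ω f) :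
    ContinuousOn (fun x : ℝ × (ℂ × ℂ) => f x.1 x.2) (univ ×ˢ Ω) := by
  obtain ⟨F, h0, -, h2, -⟩ := hf
  exact (h2 0).congr fun x hx => (h0 x.2 hx.2 x.1).symm

theorem differentiableOn (hf : IsSmoothFamily Ω f) (t : ℝ) : DifferentiableOn ℂ (f t) Ω := by
  obtain ⟨F, h0, -, -, h3⟩ := hf
  exact (h3 0 t).congr fun p hp => (h0 p hp t).symm

theorem hasDerivAt (hf : IsSmoothFamily Ω f) {p : ℂ × ℂ} (hp : p ∈ Ω) (t : ℝ) :
    HasDerivAt (fun t => f t p) (deriv (fun t => f t p) t) t := by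
  obtain ⟨F, h0, h1, -, -⟩ := hf
  have := h1 0 p hp t
  simp only [h0 p hp] at this
  exact this.differentiableAt.hasDerivAt

theorem deriv (hf : IsSmoothFamily Ω f) :
    IsSmoothFamily Ω fun t p => deriv (fun t => f t p) t := by
  obtain ⟨F, h0, h1, h2, h3⟩ := hf
  refine ⟨fun k => F (k + 1), fun p hp t => ?_, fun k => h1 (k + 1), fun k => h2 (k + 1),
    fun k => h3 (k + 1)⟩
  have := h1 0 p hp t
  simp only [h0 p hp] at this
  exact this.deriv.symm

theorem of_param {m : ℂ × ℂ → ℂ} (hm : DifferentiableOn ℂ m Ω) :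
    IsSmoothFamily Ω fun _ p => m p := by
  refine ⟨fun k _ p => if k = 0 then m p else 0, fun p _ t => by simp, fun k p _ t => ?_,
    fun k => ?_, fun k t => ?_⟩
  · simpa using hasDerivAt_const t (if k = 0 then m p else 0)
  · by_cases hk : k = 0
    · simp only [hk, if_true]
      exact ContinuousOn.comp (g := m) hm.continuousOn continuousOn_snd fun x hx => hx.2
    · simpa [hk] using continuousOn_const
  · by_cases hk : k = 0
    · simpa [hk] using hm
    · simp [hk]

theorem of_contDiff {S : ℝ → ℂ} (hS : ContDiff ℝ ∞ S) : IsSmoothFamily Ω fun t _ => S t := by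
  refine ⟨fun k t _ => iteratedDeriv k S t, fun p _ t => by simp, fun k p _ t => ?_,
    fun k => ?_, fun k t => differentiableOn_const _⟩
  · change HasDerivAt (iteratedDeriv k S) (iteratedDeriv (k + 1) S t) t
    rw [iteratedDeriv_succ]
    have hk : (k : WithTop ℕ∞) < ∞ := by exact_mod_cast WithTop.coe_lt_top _
    exact (hS.differentiable_iteratedDeriv k hk t).hasDerivAt
  · exact ((hS.continuous_iteratedDeriv k (by exact_mod_cast le_top)).comp
      continuous_fst).continuousOn

theorem mul (hf : IsSmoothFamily Ω f) (hg : IsSmoothFamily Ω g) :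
    IsSmoothFamily Ω fun t p => f t p * g t p := by
  obtain ⟨F, f0, f1, f2, f3⟩ := hf
  obtain ⟨G, g0, g1, g2, g3⟩ := hg
  refine ⟨fun k t p => ∑ ij ∈ Finset.HasAntidiagonal.antidiagonal k,
    (k.choose ij.1 : ℂ) * (F ij.1 t p * G ij.2 t p),
    fun p hp t => by simp [f0 p hp, g0 p hp], fun k p hp t => ?_, fun k => ?_, fun k t => ?_⟩
  · have := HasDerivAt.fun_sum (u := Finset.HasAntidiagonal.antidiagonal k) (x := t)
      (A := fun ij t => (k.choose ij.1 : ℂ) * (F ij.1 t p * G ij.2 t p)) fun ij _ =>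
        ((f1 ij.1 p hp t).mul (g1 ij.2 p hp t)).const_mul (k.choose ij.1 : ℂ)
    refine this.congr_deriv ?_
    beta_reduce
    rw [Finset.sum_antidiagonal_choose_succ_mul fun i j => F i t p * G j t p,
      ← Finset.sum_add_distrib]
    refine Finset.sum_congr rfl fun ij hij => ?_
    rw [Nat.choose_symm_of_eq_add (Finset.HasAntidiagonal.mem_antidiagonal.1 hij).symm]
    ring
  · exact continuousOn_finsetSum _ fun ij _ => continuousOn_const.mul ((f2 _).mul (g2 _))
  · exact DifferentiableOn.fun_sum fun ij _ => ((f3 _ t).mul (g3 _ t)).const_mul _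

theorem add (hf : IsSmoothFamily Ω f) (hg : IsSmoothFamily Ω g) :
    IsSmoothFamily Ω fun t p => f t p + g t p := by
  obtain ⟨F, f0, f1, f2, f3⟩ := hf
  obtain ⟨G, g0, g1, g2, g3⟩ := hg
  exact ⟨fun k t p => F k t p + G k t p, fun p hp t => by simp [f0 p hp, g0 p hp],
    fun k p hp t => (f1 k p hp t).add (g1 k p hp t), fun k => (f2 k).add (g2 k),
    fun k t => (f3 k t).add (g3 k t)⟩

theorem of_analytic {h : ℂ × (ℂ × ℂ) → ℂ} (hh : ∀ t : ℝ, ∀ p ∈ Ω, AnalyticAt ℂ h (t, p)) :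
    IsSmoothFamily Ω fun t p => h (t, p) := by
  let D : (ℂ × (ℂ × ℂ) → ℂ) → ℂ × (ℂ × ℂ) → ℂ := fun h x => fderiv ℂ h x (1, 0)
  have hD : ∀ k, ∀ t : ℝ, ∀ p ∈ Ω, AnalyticAt ℂ (D^[k] h) (t, p) := by
    intro k
    induction k with
    | zero => exact hh
    | succ k ih =>
      intro t p hp
      rw [Function.iterate_succ_apply']
      exact ((ContinuousLinearMap.apply ℂ ℂ ((1, 0) : ℂ × (ℂ × ℂ))).analyticAt _).fun_comp
        (ih t p hp).fderiv
  refine ⟨fun k t p => D^[k] h (t, p), fun p _ t => rfl, fun k p hp t => ?_, fun k => ?_,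
    fun k t => ?_⟩
  · have h1 : HasDerivAt (fun t : ℝ => ((t : ℂ), p)) ((1 : ℂ), (0 : ℂ × ℂ)) t :=
      (Complex.ofRealCLM.hasDerivAt (x := t)).prodMk (hasDerivAt_const t p)
    have h2 := ((hD k t p hp).differentiableAt.hasFDerivAt.restrictScalars ℝ).comp_hasDerivAt t h1
    change HasDerivAt _ (D^[k + 1] h (t, p)) t
    rw [Function.iterate_succ_apply']
    exact h2
  · intro x hx
    have h1 : ContinuousAt (fun x : ℝ × (ℂ × ℂ) => ((x.1 : ℂ), x.2)) x := by fun_prop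
    exact (ContinuousAt.comp (f := fun x : ℝ × (ℂ × ℂ) => ((x.1 : ℂ), x.2)) (g := D^[k] h)
      (hD k x.1 x.2 hx.2).continuousAt h1).continuousWithinAt
  · intro p hp
    have h1 : DifferentiableAt ℂ (fun p : ℂ × ℂ => ((t : ℂ), p)) p := by fun_prop
    exact (DifferentiableAt.comp p (f := fun p : ℂ × ℂ => ((t : ℂ), p)) (g := D^[k] h)
      (hD k t p hp).differentiableAt h1).differentiableWithinAt

end IsSmoothFamily

/-- A smooth family supported in `|t| ≤ 2`. -/
def IsTestFamily (Ω : Set (ℂ × ℂ)) (f : ℝ → ℂ × ℂ → ℂ) : Prop :=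
  IsSmoothFamily Ω f ∧ ∀ p ∈ Ω, ∀ t : ℝ, 2 < |t| → f t p = 0

namespace IsTestFamily

variable {Ω : Set (ℂ × ℂ)} {f g : ℝ → ℂ × ℂ → ℂ}

theorem eventually_eq_zero (hf : IsTestFamily Ω f) {p : ℂ × ℂ} (hp : p ∈ Ω) {t : ℝ}
    (ht : 2 < |t|) : ∀ᶠ u in 𝓝 t, f u p = 0 := by
  filter_upwards [(isOpen_lt continuous_const continuous_abs).mem_nhds ht] with u hu
    using hf.2 p hp u hu

theorem deriv (hf : IsTestFamily Ω f) : IsTestFamily Ω fun t p => deriv (fun t => f t p) t := by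
  refine ⟨hf.1.deriv, fun p hp t ht => ?_⟩
  change _root_.deriv (fun t => f t p) t = 0
  have h : (fun t => f t p) =ᶠ[𝓝 t] fun _ => 0 := hf.eventually_eq_zero hp ht
  rw [h.deriv_eq]
  exact deriv_const t (0 : ℂ)

theorem mul_left (hg : IsSmoothFamily Ω g) (hf : IsTestFamily Ω f) :
    IsTestFamily Ω fun t p => g t p * f t p :=
  ⟨hg.mul hf.1, fun p hp t ht => by simp [hf.2 p hp t ht]⟩

theorem add (hf : IsTestFamily Ω f) (hg : IsTestFamily Ω g) :
    IsTestFamily Ω fun t p => f t p + g t p :=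
  ⟨hf.1.add hg.1, fun p hp t ht => by simp [hf.2 p hp t ht, hg.2 p hp t ht]⟩

theorem exists_bound (hf : IsTestFamily Ω f) (hΩ : IsOpen Ω) {p : ℂ × ℂ} (hp : p ∈ Ω) :
    ∃ V ∈ 𝓝 p, V ⊆ Ω ∧ ∃ C : ℝ, 0 ≤ C ∧ ∀ q ∈ V, ∀ t, ‖f t q‖ ≤ C := by
  obtain ⟨r, hr, hball⟩ := Metric.nhds_basis_closedBall.mem_iff.1 (hΩ.mem_nhds hp)
  obtain ⟨C, hC⟩ := ((isCompact_Icc (a := (-2 : ℝ)) (b := 2)).prod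
    (isCompact_closedBall p r)).exists_bound_of_continuousOn
    (hf.1.continuousOn.mono (prod_mono (subset_univ _) hball))
  refine ⟨_, Metric.closedBall_mem_nhds p hr, hball, max C 0, le_max_right _ _, fun q hq t => ?_⟩
  by_cases ht : |t| ≤ 2
  · exact (hC (t, q) ⟨abs_le.1 ht, hq⟩).trans (le_max_left _ _)
  · rw [hf.2 q (hball hq) t (not_le.1 ht), norm_zero]
    exact le_max_right _ _

theorem continuous (hf : IsTestFamily Ω f) {p : ℂ × ℂ} (hp : p ∈ Ω) :
    Continuous fun t => f t p :=
  continuous_iff_continuousAt.2 fun t => (hf.1.hasDerivAt hp t).continuousAt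

theorem integrable (hf : IsTestFamily Ω f) {p : ℂ × ℂ} (hp : p ∈ Ω) :
    Integrable fun t => f t p := by
  refine (hf.continuous hp).integrable_of_hasCompactSupport ?_
  refine HasCompactSupport.intro (isCompact_Icc (a := (-2 : ℝ)) (b := 2)) fun t ht => ?_
  exact hf.2 p hp t (not_le.1 fun h => ht (abs_le.1 h))

theorem differentiableOn_integral (hf : IsTestFamily Ω f) (hΩ : IsOpen Ω) {h : ℝ → ℂ}
    (hm : Measurable h) {M : ℝ} (hM : ∀ t, ‖h t‖ ≤ M) :
    DifferentiableOn ℂ (fun p => ∫ t, h t * f t p) Ω := by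
  refine differentiableOn_integral_of_dominated hΩ
    (fun p hp => hm.aestronglyMeasurable.mul (hf.continuous hp).aestronglyMeasurable)
    (Eventually.of_forall fun t => (hf.1.differentiableOn t).const_mul _) fun p hp => ?_
  obtain ⟨V, hV, hVΩ, C, hC0, hC⟩ := hf.exists_bound hΩ hp
  have hM0 : 0 ≤ M := (norm_nonneg _).trans (hM 0)
  refine ⟨V, hV, (Icc (-2 : ℝ) 2).indicator fun _ => M * C, ?_,
    Eventually.of_forall fun t q hq => ?_⟩
  · exact (integrable_indicator_iff measurableSet_Icc).2 (integrableOn_const (by simp))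
  · by_cases ht : |t| ≤ 2
    · rw [indicator_of_mem (mem_Icc.2 (abs_le.1 ht)), norm_mul]
      have h1 := hM t
      have h2 := hC q hq t
      gcongr
    · rw [hf.2 q (hVΩ hq) t (not_le.1 ht), mul_zero, norm_zero]
      exact indicator_nonneg (fun _ _ => by positivity) _

theorem norm_integral_le (hf : IsTestFamily Ω f) {p : ℂ × ℂ} (hp : p ∈ Ω) {h : ℝ → ℂ}
    {M C : ℝ} (hM : ∀ t, ‖h t‖ ≤ M) (hC : ∀ t, ‖f t p‖ ≤ C) :
    ‖∫ t, h t * f t p‖ ≤ M * C * 4 := by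
  have hM0 : 0 ≤ M := (norm_nonneg _).trans (hM 0)
  have e : ∫ t, h t * f t p = ∫ t in Icc (-2 : ℝ) 2, h t * f t p := by
    refine (setIntegral_eq_integral_of_forall_compl_eq_zero fun t ht => ?_).symm
    rw [hf.2 p hp t (not_le.1 fun h => ht (abs_le.1 h)), mul_zero]
  rw [e]
  refine (norm_setIntegral_le_of_norm_le_const (C := M * C) (by simp) fun t _ => ?_).trans ?_
  · rw [norm_mul]
    have h1 := hM t
    have h2 := hC t
    gcongr
  · rw [Measure.real, Real.volume_Icc, ENNReal.toReal_ofReal (by norm_num)]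
    norm_num

end IsTestFamily
end
section
open MeasureTheory Filter Topology Set
open scoped Real ContDiff

/-! ### Homogeneous functions on the half line -/

/-- The function `v ↦ v ^ (-ν) f (1 / v)` on `v > 0`, extended by zero. -/
noncomputable def powFun (ν : ℂ) (f : ℝ → ℂ) (v : ℝ) : ℂ :=
  if 0 < v then (v : ℂ) ^ (-ν) * f v⁻¹ else 0

theorem powFun_of_lt {f : ℝ → ℂ} (hf : ∀ t : ℝ, 2 < |t| → f t = 0) (ν : ℂ) {v : ℝ}
    (hv : v < 1 / 2) :
    powFun ν f v = 0 := by
  unfold powFun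
  split_ifs with h
  · have : 2 < v⁻¹ := by
      rw [lt_inv_comm₀ two_pos h]
      linarith
    rw [hf _ (this.trans_le (le_abs_self _)), mul_zero]
  · rfl

theorem hasDerivAt_powFun {f f' : ℝ → ℂ} (hf : ∀ t : ℝ, 2 < |t| → f t = 0)
    (hf' : ∀ t : ℝ, 2 < |t| → f' t = 0) (hd : ∀ t, HasDerivAt f (f' t) t) (ν : ℂ) (v : ℝ) :
    HasDerivAt (powFun ν f) (powFun (ν + 1) (fun t => -ν * f t - t * f' t) v) v := by
  rcases lt_or_ge v (1 / 2) with hv | hv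
  · rw [powFun_of_lt (fun t ht => by rw [hf t ht, hf' t ht]; simp) _ hv]
    refine (hasDerivAt_const v (0 : ℂ)).congr_of_eventuallyEq ?_
    filter_upwards [gt_mem_nhds hv] with u hu using powFun_of_lt hf ν hu
  · have hv0 : 0 < v := by linarith
    have h1 : HasDerivAt (fun u : ℝ => (u : ℂ) ^ (-ν)) (-ν * (v : ℂ) ^ (-ν - 1)) v := by
      have := ((hasDerivAt_id (v : ℂ)).cpow_const (c := -ν)
        (Or.inl (by simpa using hv0))).comp_ofReal
      simpa using this
    have h2 : HasDerivAt (fun u : ℝ => f u⁻¹) ((-(v ^ 2)⁻¹ : ℝ) • f' v⁻¹) v :=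
      (hd v⁻¹).scomp v (hasDerivAt_inv hv0.ne')
    have h3 := h1.mul h2
    have hev : powFun ν f =ᶠ[𝓝 v] fun u : ℝ => (u : ℂ) ^ (-ν) * f u⁻¹ := by
      filter_upwards [lt_mem_nhds hv0] with u hu
      simp [powFun, hu]
    refine (h3.congr_of_eventuallyEq hev).congr_deriv ?_
    have hvc : (v : ℂ) ≠ 0 := by exact_mod_cast hv0.ne'
    simp only [powFun, hv0, if_true, Complex.real_smul]
    rw [show -(ν + 1) = -ν - 1 by ring, Complex.cpow_sub _ _ hvc, Complex.cpow_one]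
    push_cast
    field_simp
    ring

theorem norm_powFun_le {f : ℝ → ℂ} (hf : ∀ t : ℝ, 2 < |t| → f t = 0) {C : ℝ} (hC : ∀ t, ‖f t‖ ≤ C)
    {ν : ℂ} {c c' : ℝ} (hc : c ≤ ν.re) (hc' : ν.re ≤ c') (v : ℝ) :
    ‖powFun ν f v‖ ≤ (Ioi (1 / 4 : ℝ)).indicator (fun v => (v ^ (-c) + v ^ (-c')) * C) v := by
  have hC0 : 0 ≤ C := (norm_nonneg _).trans (hC 0)
  by_cases hv : 1 / 4 < v
  · have hv0 : 0 < v := by linarith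
    rw [indicator_of_mem (mem_Ioi.2 hv), powFun, if_pos hv0, norm_mul,
      Complex.norm_cpow_eq_rpow_re_of_pos hv0, neg_re]
    have h1 := hC v⁻¹
    have h2 : v ^ (-ν.re) ≤ v ^ (-c) + v ^ (-c') := by
      have a1 := (Real.rpow_pos_of_pos hv0 (-c)).le
      have a2 := (Real.rpow_pos_of_pos hv0 (-c')).le
      rcases le_total 1 v with h | h
      · have := Real.rpow_le_rpow_of_exponent_le h (neg_le_neg hc)
        linarith
      · have := Real.rpow_le_rpow_of_exponent_ge hv0 h (neg_le_neg hc')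
        linarith
    gcongr
  · rw [powFun_of_lt hf _ (by linarith), norm_zero]
    refine indicator_nonneg (fun v hv => ?_) _
    have : (0 : ℝ) < v := lt_trans (by norm_num) (mem_Ioi.1 hv)
    positivity

theorem integrable_powMajorant {c c' : ℝ} (hc : 1 < c) (hc' : 1 < c') (C : ℝ) :
    Integrable ((Ioi (1 / 4 : ℝ)).indicator fun v => (v ^ (-c) + v ^ (-c')) * C) := by
  rw [integrable_indicator_iff measurableSet_Ioi]
  exact ((integrableOn_Ioi_rpow_of_lt (by linarith) (by norm_num)).add
    (integrableOn_Ioi_rpow_of_lt (by linarith) (by norm_num))).mul_const C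

theorem continuous_powFun {f f' : ℝ → ℂ} (hf : ∀ t : ℝ, 2 < |t| → f t = 0)
    (hf' : ∀ t : ℝ, 2 < |t| → f' t = 0) (hd : ∀ t, HasDerivAt f (f' t) t) (ν : ℂ) :
    Continuous (powFun ν f) :=
  continuous_iff_continuousAt.2 fun v => (hasDerivAt_powFun hf hf' hd ν v).continuousAt

namespace IsTestFamily

variable {Ω : Set (ℂ × ℂ)} {f g : ℝ → ℂ × ℂ → ℂ}

theorem continuous_powFun (hf : IsTestFamily Ω f) {p : ℂ × ℂ} (hp : p ∈ Ω) (ν : ℂ) :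
    Continuous (powFun ν fun t => f t p) :=
  GaussDDS.continuous_powFun (hf.2 p hp) (hf.deriv.2 p hp) (hf.1.hasDerivAt hp) ν

theorem exists_majorant (hf : IsTestFamily Ω f) (hΩ : IsOpen Ω) {ν : ℂ × ℂ → ℂ}
    (hν : Continuous ν) {p : ℂ × ℂ} (hp : p ∈ Ω) (hp1 : 1 < (ν p).re) :
    ∃ V ∈ 𝓝 p, V ⊆ Ω ∧ ∃ b : ℝ → ℝ, Integrable b ∧
      ∀ q ∈ V, ∀ v, ‖powFun (ν q) (fun t => f t q) v‖ ≤ b v := by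
  obtain ⟨V, hV, hVΩ, C, hC0, hC⟩ := hf.exists_bound hΩ hp
  obtain ⟨c, hc1, hc⟩ := exists_between hp1
  have h1 : ∀ᶠ q in 𝓝 p, c < (ν q).re :=
    ((Complex.continuous_re.comp hν).tendsto p).eventually (lt_mem_nhds hc)
  have h2 : ∀ᶠ q in 𝓝 p, (ν q).re < (ν p).re + 1 :=
    ((Complex.continuous_re.comp hν).tendsto p).eventually (gt_mem_nhds (lt_add_one _))
  refine ⟨_, inter_mem hV (h1.and h2), inter_subset_left.trans hVΩ, _,
    integrable_powMajorant hc1 (by linarith : 1 < (ν p).re + 1) C, fun q hq v => ?_⟩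
  exact norm_powFun_le (hf.2 q (hVΩ hq.1)) (hC q hq.1) hq.2.1.le hq.2.2.le v

theorem integrable_powFun (hf : IsTestFamily Ω f) (hΩ : IsOpen Ω) {p : ℂ × ℂ} (hp : p ∈ Ω) {ν : ℂ}
    (hν : 1 < ν.re) : Integrable (powFun ν fun t => f t p) := by
  obtain ⟨V, hV, -, b, hb, h⟩ := hf.exists_majorant hΩ (ν := fun _ => ν) continuous_const hp hν
  exact hb.mono' (hf.continuous_powFun hp ν).aestronglyMeasurable
    (Eventually.of_forall (h p (mem_of_mem_nhds hV)))

theorem differentiableOn_powFun (hf : IsTestFamily Ω f) {ν : ℂ × ℂ → ℂ} (hν : Differentiable ℂ ν)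
    (v : ℝ) : DifferentiableOn ℂ (fun p => powFun (ν p) (fun t => f t p) v) Ω := by
  unfold powFun
  split_ifs with h
  · refine DifferentiableOn.mul ?_ (hf.1.differentiableOn _)
    exact (hν.neg.const_cpow (Or.inl (by exact_mod_cast h.ne'))).differentiableOn
  · exact differentiableOn_const _

theorem differentiableOn_integral_powFun (hf : IsTestFamily Ω f) (hΩ : IsOpen Ω) {ν : ℂ × ℂ → ℂ}
    (hν : Differentiable ℂ ν) {h : ℝ → ℂ} (hm : Measurable h) {M : ℝ} (hM : ∀ t, ‖h t‖ ≤ M) :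
    DifferentiableOn ℂ (fun p => ∫ v, h v * powFun (ν p) (fun t => f t p) v)
      (Ω ∩ {p | 1 < (ν p).re}) := by
  have hopen : IsOpen (Ω ∩ {p | 1 < (ν p).re}) :=
    hΩ.inter (isOpen_lt continuous_const (Complex.continuous_re.comp hν.continuous))
  refine differentiableOn_integral_of_dominated hopen
    (fun p hp => hm.aestronglyMeasurable.mul (hf.continuous_powFun hp.1 _).aestronglyMeasurable)
    (Eventually.of_forall fun v =>
      ((hf.differentiableOn_powFun hν v).mono inter_subset_left).const_mul _) fun p hp => ?_
  obtain ⟨V, hV, -, b, hb, hVb⟩ := hf.exists_majorant hΩ hν.continuous hp.1 hp.2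
  refine ⟨V, hV, fun v => M * b v, hb.const_mul M, Eventually.of_forall fun v q hq => ?_⟩
  have hM0 : 0 ≤ M := (norm_nonneg _).trans (hM 0)
  rw [norm_mul]
  exact mul_le_mul (hM v) (hVb q hq v) (norm_nonneg _) hM0

/-- The test family with `d/dv (v ^ (-ν - k) f (1/v)) = v ^ (-ν - k - 1) (powDeriv f) (1/v)`. -/
theorem powDeriv (hf : IsTestFamily Ω f) {ν : ℂ × ℂ → ℂ} (hν : Differentiable ℂ ν) :
    IsTestFamily Ω fun t p => -ν p * f t p - t * _root_.deriv (fun t => f t p) t := by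
  have h1 := mul_left (IsSmoothFamily.of_param hν.neg.differentiableOn) hf
  have h2 := mul_left (IsSmoothFamily.of_contDiff (S := fun t : ℝ => (-t : ℂ))
    (Complex.ofRealCLM.contDiff.neg)) hf.deriv
  have h3 := h1.add h2
  simpa [sub_eq_add_neg, neg_mul] using h3

end IsTestFamily

/-- The iterated derivatives of `v ↦ v ^ (-ν) f (1 / v)` are `v ↦ v ^ (-ν - k) fₖ (1 / v)`. -/
noncomputable def powIter (ν : ℂ × ℂ → ℂ) (f : ℝ → ℂ × ℂ → ℂ) : ℕ → ℝ → ℂ × ℂ → ℂ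
  | 0 => f
  | k + 1 => fun t p => -(ν p + k) * powIter ν f k t p - t * deriv (fun t => powIter ν f k t p) t

theorem isTestFamily_powIter {Ω : Set (ℂ × ℂ)} {f : ℝ → ℂ × ℂ → ℂ} (hf : IsTestFamily Ω f)
    {ν : ℂ × ℂ → ℂ} (hν : Differentiable ℂ ν) (k : ℕ) : IsTestFamily Ω (powIter ν f k) := by
  induction k with
  | zero => exact hf
  | succ k ih => exact ih.powDeriv (hν.add_const (k : ℂ))

theorem hasDerivAt_powFun_powIter {Ω : Set (ℂ × ℂ)} {f : ℝ → ℂ × ℂ → ℂ} (hf : IsTestFamily Ω f)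
    {ν : ℂ × ℂ → ℂ} (hν : Differentiable ℂ ν) {p : ℂ × ℂ} (hp : p ∈ Ω) (k : ℕ) (v : ℝ) :
    HasDerivAt (powFun (ν p + k) fun t => powIter ν f k t p)
      (powFun (ν p + (k + 1 : ℕ)) (fun t => powIter ν f (k + 1) t p) v) v := by
  have h := isTestFamily_powIter hf hν k
  have := hasDerivAt_powFun (h.2 p hp) (h.deriv.2 p hp) (h.1.hasDerivAt hp) (ν p + k) v
  push_cast
  rw [← add_assoc]
  exact this

/-- Integration by parts for the Mellin transform of a test family. -/
theorem mul_integral_powFun {Ω : Set (ℂ × ℂ)} (hΩ : IsOpen Ω) {f : ℝ → ℂ × ℂ → ℂ}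
    (hf : IsTestFamily Ω f) {p : ℂ × ℂ} (hp : p ∈ Ω) {ν : ℂ} (hν : 1 < ν.re) :
    (ν - 1) * ∫ v, powFun ν (fun t => f t p) v =
      -∫ v, powFun (ν + 1) (fun t => deriv (fun t => f t p) t) v := by
  have hd := hasDerivAt_powFun (hf.2 p hp) (hf.deriv.2 p hp) (hf.1.hasDerivAt hp) (ν - 1)
  have hsplit : ∀ v, powFun (ν - 1 + 1)
      (fun t => -(ν - 1) * f t p - t * deriv (fun t => f t p) t) v =
      -(ν - 1) * powFun ν (fun t => f t p) v -
        powFun (ν + 1) (fun t => deriv (fun t => f t p) t) v := by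
    intro v
    unfold powFun
    split_ifs with h
    · have hvc : (v : ℂ) ≠ 0 := by exact_mod_cast h.ne'
      rw [show -(ν + 1) = -ν - 1 by ring, Complex.cpow_sub _ _ hvc, Complex.cpow_one,
        sub_add_cancel]
      push_cast
      field_simp
    · simp
  have i1 := hf.integrable_powFun hΩ hp hν
  have i2 := hf.deriv.integrable_powFun hΩ hp (ν := ν + 1) (by simp; linarith)
  have hbot : Tendsto (powFun (ν - 1) fun t => f t p) atBot (𝓝 0) := by
    refine tendsto_const_nhds.congr' ?_
    filter_upwards [eventually_lt_atBot (0 : ℝ)] with v hv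
    rw [powFun, if_neg hv.not_gt]
  have htop : Tendsto (powFun (ν - 1) fun t => f t p) atTop (𝓝 0) := by
    obtain ⟨V, hV, -, C, -, hC⟩ := hf.exists_bound hΩ hp
    have h0 : Tendsto (fun v : ℝ => v ^ (-(ν.re - 1)) * C) atTop (𝓝 (0 * C)) :=
      (tendsto_rpow_neg_atTop (by linarith)).mul_const C
    rw [zero_mul] at h0
    refine squeeze_zero_norm' ?_ h0
    filter_upwards [eventually_gt_atTop (0 : ℝ)] with v hv
    rw [powFun, if_pos hv, norm_mul, Complex.norm_cpow_eq_rpow_re_of_pos hv]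
    have := hC p (mem_of_mem_nhds hV) v⁻¹
    simp only [neg_re, sub_re, one_re]
    gcongr
  have key := integral_of_hasDerivAt_of_tendsto hd
    (((i1.const_mul _).sub i2).congr (Eventually.of_forall fun v => (hsplit v).symm)) hbot htop
  simp only [hsplit] at key
  rw [integral_sub (i1.const_mul _) i2, integral_const_mul, sub_zero] at key
  linear_combination -key

/-- Iterated `t`-derivatives of a family. -/
noncomputable def derivIter (f : ℝ → ℂ × ℂ → ℂ) : ℕ → ℝ → ℂ × ℂ → ℂ
  | 0 => f
  | k + 1 => fun t p => deriv (fun t => derivIter f k t p) t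

theorem isTestFamily_derivIter {Ω : Set (ℂ × ℂ)} {f : ℝ → ℂ × ℂ → ℂ} (hf : IsTestFamily Ω f)
    (k : ℕ) : IsTestFamily Ω (derivIter f k) := by
  induction k with
  | zero => exact hf
  | succ k ih => exact ih.deriv

theorem prod_mul_integral_powFun {Ω : Set (ℂ × ℂ)} (hΩ : IsOpen Ω) {f : ℝ → ℂ × ℂ → ℂ}
    (hf : IsTestFamily Ω f) {p : ℂ × ℂ} (hp : p ∈ Ω) {ν : ℂ} (hν : 1 < ν.re) (K : ℕ) :
    (∏ j ∈ Finset.range K, (ν - 1 + j)) * ∫ v, powFun ν (fun t => f t p) v =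
      (-1) ^ K * ∫ v, powFun (ν + K) (fun t => derivIter f K t p) v := by
  induction K with
  | zero => simp [derivIter]
  | succ K ih =>
    have h := mul_integral_powFun hΩ (isTestFamily_derivIter hf K) hp (ν := ν + K) (by
      simp
      linarith [K.cast_nonneg (α := ℝ)])
    rw [Finset.prod_range_succ, mul_right_comm, ih]
    push_cast
    rw [← add_assoc, pow_succ]
    simp only [derivIter]
    linear_combination (-1) ^ K * h

end
section
open MeasureTheory Filter Topology Set
open scoped Real ContDiff

/-! ### The angular cutoff and the two test families -/

/-- A smooth cutoff in the slope `t`, with `cutoff t + cutoff t⁻¹ = 1` for `t > 0`. -/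
noncomputable def cutoff (t : ℝ) : ℝ := Real.smoothTransition (1 / 2 + (1 - t ^ 2) / (1 + t ^ 2))

theorem contDiff_cutoff : ContDiff ℝ ∞ cutoff := by
  unfold cutoff
  refine Real.smoothTransition.contDiff.comp (contDiff_const.add (ContDiff.div ?_ ?_ fun t => ?_))
  · fun_prop
  · fun_prop
  · positivity

theorem cutoff_zero : cutoff 0 = 1 := Real.smoothTransition.one_of_one_le (by norm_num)

theorem cutoff_neg (t : ℝ) : cutoff (-t) = cutoff t := by simp [cutoff]

theorem cutoff_of_two_lt {t : ℝ} (ht : 2 < |t|) : cutoff t = 0 := by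
  refine Real.smoothTransition.zero_of_nonpos ?_
  have h : 4 < t ^ 2 := by
    rw [← sq_abs]
    nlinarith
  have h2 : (1 - t ^ 2) / (1 + t ^ 2) ≤ -(1 / 2) := by
    rw [div_le_iff₀ (by positivity)]
    linarith
  linarith

theorem norm_cutoff_le (t : ℝ) : ‖(cutoff t : ℂ)‖ ≤ 1 := by
  rw [Complex.norm_real, Real.norm_of_nonneg
    (show 0 ≤ cutoff t from Real.smoothTransition.nonneg _)]
  exact Real.smoothTransition.le_one _

theorem smoothTransition_add (u : ℝ) :
    Real.smoothTransition u + Real.smoothTransition (1 - u) = 1 := by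
  unfold Real.smoothTransition
  rw [sub_sub_cancel, add_comm (expNegInvGlue (1 - u)), ← add_div,
    div_self (Real.smoothTransition.pos_denom u).ne']

theorem cutoff_add_cutoff_inv {t : ℝ} (ht : t ≠ 0) : cutoff t + cutoff t⁻¹ = 1 := by
  have h := smoothTransition_add (1 / 2 + (1 - t ^ 2) / (1 + t ^ 2))
  have h1 : 1 + t ^ 2 ≠ 0 := by positivity
  have h2 : t ^ 2 + 1 ≠ 0 := by positivity
  have h3 : 1 / 2 + (1 - t⁻¹ ^ 2) / (1 + t⁻¹ ^ 2) = 1 - (1 / 2 + (1 - t ^ 2) / (1 + t ^ 2)) := by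
    have h4 : (1 - t⁻¹ ^ 2) / (1 + t⁻¹ ^ 2) = (t ^ 2 - 1) / (1 + t ^ 2) := by
      rw [div_eq_div_iff (by positivity) h1]
      field_simp
      ring
    rw [h4]
    field_simp
    ring
  rw [cutoff, cutoff, h3]
  exact h

theorem analyticAt_arctan {z : ℂ} (hz : |z.im| < 1) : AnalyticAt ℂ Complex.arctan z := by
  have him := abs_lt.1 hz
  have h1 : 0 < (1 + z * I).re := by simp; linarith
  have h2 : 0 < (1 - z * I).re := by simp; linarith
  have hne : 1 - z * I ≠ 0 := fun h => by rw [h, zero_re] at h2; exact lt_irrefl _ h2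
  have hmem : (1 + z * I) / (1 - z * I) ∈ slitPlane := by
    rw [Complex.mem_slitPlane_iff]
    by_contra! h
    obtain ⟨hre, him⟩ := h
    set r := (1 + z * I) / (1 - z * I) with hr
    have hrr : r = (r.re : ℂ) := Complex.ext (by simp) (by simp [him])
    have h3 : 1 + z * I = r.re * (1 - z * I) := by rw [← hrr, hr, div_mul_cancel₀ _ hne]
    have h4 := congrArg re h3
    rw [Complex.re_ofReal_mul] at h4
    nlinarith
  unfold Complex.arctan
  have ha : AnalyticAt ℂ (fun z : ℂ => (1 + z * I) / (1 - z * I)) z :=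
    (analyticAt_const.add (analyticAt_id.mul analyticAt_const)).div
      (analyticAt_const.sub (analyticAt_id.mul analyticAt_const)) hne
  exact analyticAt_const.mul (ha.clog hmem)

/-- The entire part of `arctan z / z`. -/
noncomputable def arctanQuot (z : ℂ) : ℂ := dslope Complex.arctan 0 z

theorem analyticAt_arctanQuot {z : ℂ} (hz : |z.im| < 1) : AnalyticAt ℂ arctanQuot z := by
  have hopen : IsOpen {z : ℂ | |z.im| < 1} :=
    isOpen_lt (continuous_abs.comp Complex.continuous_im) continuous_const
  have h0 : {z : ℂ | |z.im| < 1} ∈ 𝓝 (0 : ℂ) := hopen.mem_nhds (by simp)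
  have hd : DifferentiableOn ℂ Complex.arctan {z : ℂ | |z.im| < 1} := fun z hz =>
    (analyticAt_arctan hz).differentiableAt.differentiableWithinAt
  exact ((Complex.differentiableOn_dslope h0).2 hd).analyticAt (hopen.mem_nhds hz)

theorem arctanQuot_ofReal {t : ℝ} (ht : t ≠ 0) :
    arctanQuot t = ((Real.arctan t / t : ℝ) : ℂ) := by
  rw [arctanQuot, dslope_of_ne _ (by exact_mod_cast ht), slope_def_field, ← Complex.ofReal_arctan,
    Complex.arctan]
  simp

theorem arctanQuot_mem_slitPlane (t : ℝ) : 2 / π * arctanQuot t ∈ slitPlane := by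
  have hpi : (0 : ℝ) < 2 / π := by positivity
  by_cases ht : t = 0
  · have h : HasDerivAt Complex.arctan 1 ((0 : ℝ) : ℂ) := by
      have h1 : DifferentiableAt ℂ Complex.arctan ((0 : ℝ) : ℂ) :=
        (analyticAt_arctan (by simp)).differentiableAt
      have h2 := h1.hasDerivAt.comp_ofReal
      have h3 := (Real.hasDerivAt_arctan 0).ofReal_comp
      simp only [Complex.ofReal_arctan] at h3
      have h4 := h2.unique h3
      rw [← show deriv Complex.arctan ((0 : ℝ) : ℂ) = 1 by rw [h4]; simp]
      exact h1.hasDerivAt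
    rw [ht, arctanQuot, Complex.ofReal_zero, dslope_same]
    rw [Complex.ofReal_zero] at h
    rw [h.deriv, mul_one, Complex.mem_slitPlane_iff]
    left
    exact_mod_cast hpi
  · rw [arctanQuot_ofReal ht, Complex.mem_slitPlane_iff]
    left
    have hq : 0 < Real.arctan t / t := by
      rcases lt_or_gt_of_ne ht with h | h
      · exact div_pos_of_neg_of_neg (Real.arctan_lt_zero.2 h) h
      · exact div_pos (Real.arctan_pos.2 h) h
    have := mul_pos hpi hq
    exact_mod_cast this

/-- The parameter domain: `w ∉ {2, 3, 4, …}`. -/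
def paramDomain : Set (ℂ × ℂ) := univ ×ˢ regularW

theorem isOpen_paramDomain : IsOpen paramDomain := isOpen_univ.prod isOpen_regularW

theorem one_add_sq_mem_slitPlane (t : ℝ) : 1 + (t : ℂ) ^ 2 ∈ slitPlane := by
  rw [Complex.mem_slitPlane_iff]
  left
  have : 1 + (t : ℂ) ^ 2 = ((1 + t ^ 2 : ℝ) : ℂ) := by push_cast; rfl
  rw [this, Complex.ofReal_re]
  positivity

/-- The part of the summand that is regular on the axis. -/
noncomputable def regularPart (x : ℂ × (ℂ × ℂ)) : ℂ :=
  (1 + x.1 ^ 2) ^ (-x.2.1) * ((x.2.2 - 1) + 2 * riemannZeta₁ x.2.2 +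
    2 * (gammaFactor x.2.2 * zetaTail (2 / π * Complex.arctan x.1, x.2.2)))

/-- The coefficient of the singular part of the summand. -/
noncomputable def singularPart (x : ℂ × (ℂ × ℂ)) : ℂ :=
  (1 + x.1 ^ 2) ^ (-x.2.1) * (gammaFactor x.2.2 * (2 / π * arctanQuot x.1) ^ (x.2.2 - 1))

theorem analyticAt_snd_snd (x : ℂ × (ℂ × ℂ)) : AnalyticAt ℂ (fun x : ℂ × (ℂ × ℂ) => x.2.2) x :=
  AnalyticAt.fun_comp (f := fun x : ℂ × (ℂ × ℂ) => x.2) analyticAt_snd analyticAt_snd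

theorem analyticAt_snd_fst (x : ℂ × (ℂ × ℂ)) : AnalyticAt ℂ (fun x : ℂ × (ℂ × ℂ) => x.2.1) x :=
  AnalyticAt.fun_comp (f := fun x : ℂ × (ℂ × ℂ) => x.2) analyticAt_fst analyticAt_snd

theorem analyticAt_one_add_sq_cpow (t : ℝ) (p : ℂ × ℂ) :
    AnalyticAt ℂ (fun x : ℂ × (ℂ × ℂ) => (1 + x.1 ^ 2) ^ (-x.2.1)) ((t : ℂ), p) :=
  AnalyticAt.cpow (analyticAt_const.add (analyticAt_fst.pow 2)) (analyticAt_snd_fst _).neg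
    (one_add_sq_mem_slitPlane t)

theorem analyticAt_gammaFactor_snd (t : ℂ) {p : ℂ × ℂ} (hp : p ∈ paramDomain) :
    AnalyticAt ℂ (fun x : ℂ × (ℂ × ℂ) => gammaFactor x.2.2) (t, p) :=
  AnalyticAt.fun_comp (g := gammaFactor) (f := fun x : ℂ × (ℂ × ℂ) => x.2.2)
    (differentiableOn_gammaFactor.analyticAt (isOpen_regularW.mem_nhds hp.2)) (analyticAt_snd_snd _)

theorem norm_arctan_lt_one (t : ℝ) : ‖2 / π * Complex.arctan t‖ < 1 := by
  rw [← Complex.ofReal_arctan]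
  have : (2 / π * Real.arctan t : ℂ) = ((2 / π * Real.arctan t : ℝ) : ℂ) := by push_cast; rfl
  rw [this, Complex.norm_real, Real.norm_eq_abs, abs_mul, abs_of_pos (by positivity : 0 < 2 / π)]
  have h : |Real.arctan t| < π / 2 :=
    abs_lt.2 ⟨Real.neg_pi_div_two_lt_arctan t, Real.arctan_lt_pi_div_two t⟩
  calc 2 / π * |Real.arctan t| < 2 / π * (π / 2) := by gcongr
    _ = 1 := by field_simp

theorem analyticAt_regularPart (t : ℝ) {p : ℂ × ℂ} (hp : p ∈ paramDomain) :
    AnalyticAt ℂ regularPart ((t : ℂ), p) := by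
  have h1 : AnalyticAt ℂ (fun x : ℂ × (ℂ × ℂ) => riemannZeta₁ x.2.2) ((t : ℂ), p) :=
    AnalyticAt.fun_comp (g := riemannZeta₁) (f := fun x : ℂ × (ℂ × ℂ) => x.2.2)
      (differentiable_riemannZeta₁.analyticAt _) (analyticAt_snd_snd _)
  have h2 : AnalyticAt ℂ (fun x : ℂ × (ℂ × ℂ) => Complex.arctan x.1) ((t : ℂ), p) :=
    AnalyticAt.fun_comp (g := Complex.arctan) (f := fun x : ℂ × (ℂ × ℂ) => x.1)
      (analyticAt_arctan (by simp)) analyticAt_fst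
  have h3 : AnalyticAt ℂ zetaTail (2 / π * Complex.arctan t, p.2) :=
    analyticAt_of_differentiableOn (Metric.isOpen_ball.prod isOpen_regularW)
      differentiableOn_zetaTail ⟨by simpa using norm_arctan_lt_one t, hp.2⟩
  have h4 : AnalyticAt ℂ (fun x : ℂ × (ℂ × ℂ) => zetaTail (2 / π * Complex.arctan x.1, x.2.2))
      ((t : ℂ), p) :=
    AnalyticAt.fun_comp (g := zetaTail)
      (f := fun x : ℂ × (ℂ × ℂ) => (2 / π * Complex.arctan x.1, x.2.2)) h3
      ((analyticAt_const.mul h2).prod (analyticAt_snd_snd _))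
  exact (analyticAt_one_add_sq_cpow t p).mul ((((analyticAt_snd_snd _).sub analyticAt_const).add
    (analyticAt_const.mul h1)).add
    (analyticAt_const.mul ((analyticAt_gammaFactor_snd _ hp).mul h4)))

theorem analyticAt_singularPart (t : ℝ) {p : ℂ × ℂ} (hp : p ∈ paramDomain) :
    AnalyticAt ℂ singularPart ((t : ℂ), p) := by
  have h1 : AnalyticAt ℂ (fun x : ℂ × (ℂ × ℂ) => arctanQuot x.1) ((t : ℂ), p) :=
    AnalyticAt.fun_comp (g := arctanQuot) (f := fun x : ℂ × (ℂ × ℂ) => x.1)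
      (analyticAt_arctanQuot (by simp)) analyticAt_fst
  exact (analyticAt_one_add_sq_cpow t p).mul ((analyticAt_gammaFactor_snd _ hp).mul
    (AnalyticAt.cpow (analyticAt_const.mul h1) ((analyticAt_snd_snd _).sub analyticAt_const)
      (arctanQuot_mem_slitPlane t)))

/-- The regular part, cut off. -/
noncomputable def regularFamily (t : ℝ) (p : ℂ × ℂ) : ℂ := regularPart (t, p) * cutoff t

/-- The singular part, cut off. -/
noncomputable def singularFamily (t : ℝ) (p : ℂ × ℂ) : ℂ := singularPart (t, p) * cutoff t

theorem isTestFamily_cutoff (Ω : Set (ℂ × ℂ)) : IsTestFamily Ω fun t _ => (cutoff t : ℂ) :=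
  ⟨IsSmoothFamily.of_contDiff (Complex.ofRealCLM.contDiff.comp contDiff_cutoff),
    fun p _ t ht => by simp [cutoff_of_two_lt ht]⟩

theorem isTestFamily_regularFamily : IsTestFamily paramDomain regularFamily :=
  IsTestFamily.mul_left (IsSmoothFamily.of_analytic fun t _ hp => analyticAt_regularPart t hp)
    (isTestFamily_cutoff _)

theorem isTestFamily_singularFamily : IsTestFamily paramDomain singularFamily :=
  IsTestFamily.mul_left (IsSmoothFamily.of_analytic fun t _ hp => analyticAt_singularPart t hp)
    (isTestFamily_cutoff _)

theorem zetaTail_neg (a w : ℂ) : zetaTail (-a, w) = zetaTail (a, w) := by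
  unfold zetaTail
  refine tsum_congr fun k => ?_
  simp [(even_two_mul (k + 1)).neg_pow]

theorem zetaTail_zero (w : ℂ) : zetaTail (0, w) = 0 := by simp [zetaTail]

theorem regularFamily_neg (t : ℝ) (p : ℂ × ℂ) : regularFamily (-t) p = regularFamily t p := by
  unfold regularFamily regularPart
  simp only
  rw [cutoff_neg, ← Complex.ofReal_arctan, ← Complex.ofReal_arctan, Real.arctan_neg,
    Complex.ofReal_neg, Complex.ofReal_neg, neg_sq, mul_neg, zetaTail_neg]

theorem regularFamily_zero (p : ℂ × ℂ) :
    regularFamily 0 p = (p.2 - 1) + 2 * riemannZeta₁ p.2 := by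
  unfold regularFamily regularPart
  simp only
  rw [cutoff_zero, ← Complex.ofReal_arctan, Real.arctan_zero, Complex.ofReal_zero, mul_zero,
    zetaTail_zero]
  simp

/-! ### Splitting the double series -/

theorem latticeTerm_symm (s w : ℂ) {x y : ℝ} (hx : 0 < x) (hy : 0 < y) :
    latticeTerm s w x y = latticeTerm s w y x := by
  unfold latticeTerm
  have h : (2 / π * Real.arctan (y / x) : ℝ) = 1 - 2 / π * Real.arctan (x / y) := by
    rw [← inv_div x y, Real.arctan_inv_of_pos (by positivity)]
    field_simp
  rw [add_comm (x ^ 2), h, AddCircle.coe_sub, AddCircle.coe_period, zero_sub,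
    HurwitzZeta.cosZeta_neg]

theorem ofReal_sq_cpow {x : ℝ} (hx : 0 < x) (s : ℂ) :
    ((x ^ 2 : ℝ) : ℂ) ^ (-s) = (x : ℂ) ^ (-(2 * s)) := by
  rw [sq, Complex.ofReal_mul, Complex.mul_cpow_ofReal_nonneg hx.le hx.le,
    ← Complex.cpow_add _ _ (by exact_mod_cast hx.ne')]
  congr 1
  ring

theorem sub_one_mul_latticeTerm_mul_cutoff (s : ℂ) {w : ℂ} (hw : w ∈ regularW) {x y : ℝ}
    (hx : 0 < x) (hy : 0 < y) :
    (w - 1) * latticeTerm s w x y * cutoff (y / x) =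
      (x : ℂ) ^ (-(2 * s)) * regularFamily (y / x) (s, w) +
        (y : ℂ) ^ (-(2 * s)) *
          powFun (2 * s + w - 1) (fun t => singularFamily t (s, w)) (x / y) := by
  have ht : 0 < y / x := div_pos hy hx
  have hinv : (x / y)⁻¹ = y / x := inv_div x y
  have hxt : y = x * (y / x) := by field_simp
  generalize hT : y / x = t at *
  have hat : 0 < Real.arctan t := Real.arctan_pos.2 ht
  have ha : 0 < 2 / π * Real.arctan t := by positivity
  have ha1 : 2 / π * Real.arctan t < 1 := by
    calc 2 / π * Real.arctan t < 2 / π * (π / 2) := by gcongr; exact Real.arctan_lt_pi_div_two t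
      _ = 1 := by field_simp
  have hz := sub_one_mul_cosZeta ha ha1 hw
  have hq : ((x ^ 2 + y ^ 2 : ℝ) : ℂ) ^ (-s) =
      (x : ℂ) ^ (-(2 * s)) * (1 + (t : ℂ) ^ 2) ^ (-s) := by
    rw [show x ^ 2 + y ^ 2 = x ^ 2 * (1 + t ^ 2) by rw [hxt]; ring, Complex.ofReal_mul,
      Complex.mul_cpow_ofReal_nonneg (by positivity) (by positivity)]
    rw [ofReal_sq_cpow hx]
    push_cast
    rfl
  have hp : (y : ℂ) ^ (-(2 * s)) * ((x / y : ℝ) : ℂ) ^ (-(2 * s + w - 1)) =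
      (x : ℂ) ^ (-(2 * s)) * (t : ℂ) ^ (w - 1) := by
    have hxy : ((x / y : ℝ) : ℂ) = (t : ℂ)⁻¹ := by rw [← hinv]; push_cast; simp
    have htc : (t : ℂ) ≠ 0 := by exact_mod_cast ht.ne'
    rw [hxy, Complex.inv_cpow _ _ (by
        rw [Complex.arg_ofReal_of_nonneg ht.le]
        exact Real.pi_pos.ne),
      ← Complex.cpow_neg, neg_neg, hxt, Complex.ofReal_mul,
      Complex.mul_cpow_ofReal_nonneg hx.le ht.le, mul_assoc, ← Complex.cpow_add _ _ htc]
    congr 2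
    ring
  have hc : ((2 / π * Real.arctan t : ℝ) : ℂ) ^ (w - 1) =
      (t : ℂ) ^ (w - 1) * (2 / π * arctanQuot t) ^ (w - 1) := by
    rw [arctanQuot_ofReal ht.ne', show (2 / π * ((Real.arctan t / t : ℝ) : ℂ)) =
      ((2 / π * (Real.arctan t / t) : ℝ) : ℂ) by push_cast; rfl,
      ← Complex.mul_cpow_ofReal_nonneg ht.le (by positivity), ← Complex.ofReal_mul]
    congr 2
    field_simp
  have hz2 : zetaTail (2 / π * Complex.arctan t, w) =
      zetaTail (((2 / π * Real.arctan t : ℝ) : ℂ), w) := by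
    rw [← Complex.ofReal_arctan]
    push_cast
    rfl
  unfold powFun
  rw [if_pos (by positivity), hinv, ← mul_assoc, hp]
  unfold regularFamily singularFamily regularPart singularPart latticeTerm
  rw [hT, hq, hz2]
  rw [hc] at hz
  linear_combination 2 * (x : ℂ) ^ (-(2 * s)) * (1 + (t : ℂ) ^ 2) ^ (-s) * (cutoff t : ℂ) * hz

theorem sub_one_mul_latticeTerm_zero (s : ℂ) {w : ℂ} (hw : w ≠ 1) {x : ℝ} (hx : 0 < x) :
    (w - 1) * latticeTerm s w x 0 = (x : ℂ) ^ (-(2 * s)) * regularFamily 0 (s, w) := by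
  have h1 : ((x ^ 2 + 0 ^ 2 : ℝ) : ℂ) ^ (-s) = (x : ℂ) ^ (-(2 * s)) := by
    rw [← ofReal_sq_cpow hx, zero_pow two_ne_zero, add_zero]
  have h2 := riemannZeta_eq_inv_sub_mul hw
  have h3 : w - 1 ≠ 0 := sub_ne_zero.2 hw
  rw [regularFamily_zero, latticeTerm, h1, zero_div, Real.arctan_zero, mul_zero,
    QuotientAddGroup.mk_zero, HurwitzZeta.cosZeta_zero, h2]
  field_simp
end
section
open MeasureTheory Filter Topology Set
open scoped Real ContDiff

theorem summable_regular_part {p : ℂ × ℂ} (hp : p ∈ paramDomain) (hs : 1 < p.1.re) :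
    Summable fun x : ℕ × ℕ =>
      ((x.1 : ℂ) + 1) ^ (-(2 * p.1)) * regularFamily ((x.2 + 1) / (x.1 + 1)) p := by
  obtain ⟨V, hV, -, C, hC0, hC⟩ := isTestFamily_regularFamily.exists_bound isOpen_paramDomain hp
  refine ((summable_prod_rpow hs).mul_left (C * 2 ^ p.1.re)).of_norm_bounded fun x => ?_
  have hx : (0 : ℝ) < x.1 + 1 := by positivity
  have hy : (0 : ℝ) < x.2 + 1 := by positivity
  by_cases ht : 2 < |((x.2 : ℝ) + 1) / (x.1 + 1)|
  · rw [isTestFamily_regularFamily.2 p hp _ ht, mul_zero, norm_zero]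
    positivity
  · rw [not_lt, abs_of_pos (div_pos hy hx), div_le_iff₀ hx] at ht
    rw [norm_mul, show ((x.1 : ℂ) + 1) = ((x.1 + 1 : ℝ) : ℂ) by push_cast; rfl,
      Complex.norm_cpow_eq_rpow_re_of_pos hx]
    have h1 := hC p (mem_of_mem_nhds hV) (((x.2 : ℝ) + 1) / (x.1 + 1))
    have h2 : ((x.1 : ℝ) + 1) ^ (-p.1.re) ≤ 2 ^ p.1.re * ((x.2 : ℝ) + 1) ^ (-p.1.re) := by
      have : (2 * ((x.1 : ℝ) + 1)) ^ (-p.1.re) ≤ ((x.2 : ℝ) + 1) ^ (-p.1.re) :=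
        Real.rpow_le_rpow_of_nonpos hy ht (by linarith)
      rw [Real.mul_rpow zero_le_two hx.le, Real.rpow_neg zero_le_two,
        inv_mul_le_iff₀ (by positivity)] at this
      exact this
    have h3 : ((x.1 : ℝ) + 1) ^ (-(2 * p.1)).re =
        ((x.1 : ℝ) + 1) ^ (-p.1.re) * ((x.1 : ℝ) + 1) ^ (-p.1.re) := by
      rw [← Real.rpow_add hx]
      congr 1
      simp
      ring
    rw [h3]
    calc _ ≤ ((x.1 : ℝ) + 1) ^ (-p.1.re) * (2 ^ p.1.re * ((x.2 : ℝ) + 1) ^ (-p.1.re)) * C := by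
          gcongr
      _ = _ := by ring

/-- The exponent of the homogeneous summand. -/
def dualExponent (p : ℂ × ℂ) : ℂ := 2 * p.1 + p.2 - 1

theorem tsum_int_even {f : ℝ → ℂ} (hf : ∀ t, f (-t) = f t) {y : ℝ} {a : ℂ}
    (h : HasSum (fun n : ℤ => f (n / y)) a) :
    a = f 0 + 2 * ∑' n : ℕ, f ((n + 1) / y) := by
  have h1 : Summable fun n : ℕ => f ((n + 1) / y) := by
    have := h.summable.comp_injective (i := fun n : ℕ => ((n : ℤ) + 1)) fun a b h => by
      simpa using h
    refine this.congr fun n => ?_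
    simp
  have h2 := HasSum.of_add_one_of_neg_add_one (f := fun n : ℤ => f (n / y))
    (m := ∑' n : ℕ, f ((n + 1) / y)) (m' := ∑' n : ℕ, f ((n + 1) / y)) (by simpa using h1.hasSum)
    (by simpa only [Int.cast_neg, Int.cast_add, Int.cast_natCast, Int.cast_one, neg_div, hf]
      using h1.hasSum)
  rw [h.unique h2]
  simp only [Int.cast_zero, zero_div]
  ring

theorem tsum_int_half_line {f : ℝ → ℂ} (hf : ∀ t ≤ 0, f t = 0) {y : ℝ} (hy : 0 < y) {a : ℂ}
    (h : HasSum (fun n : ℤ => f (n / y)) a) : a = ∑' n : ℕ, f ((n + 1) / y) := by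
  have h1 : Summable fun n : ℕ => f ((n + 1) / y) := by
    have := h.summable.comp_injective (i := fun n : ℕ => ((n : ℤ) + 1)) fun a b h => by
      simpa using h
    refine this.congr fun n => ?_
    simp
  have h0 : ∀ n : ℕ, f (-((n : ℝ) + 1) / y) = 0 := fun n =>
    hf _ (div_nonpos_of_nonpos_of_nonneg (by linarith [n.cast_nonneg (α := ℝ)]) hy.le)
  have h2 := HasSum.of_add_one_of_neg_add_one (f := fun n : ℤ => f (n / y))
    (m := ∑' n : ℕ, f ((n + 1) / y)) (m' := 0) (by simpa using h1.hasSum)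
    (by simpa only [Int.cast_neg, Int.cast_add, Int.cast_natCast, Int.cast_one, h0]
      using hasSum_zero)
  rw [h.unique h2]
  simp [hf 0 le_rfl]

/-- Summing a symmetric array by means of a partition of unity. -/
theorem tsum_eq_of_partition {f c U V : ℕ × ℕ → ℂ} (hf : Summable f) (hc : ∀ x, ‖c x‖ ≤ 1)
    (hc1 : ∀ x : ℕ × ℕ, c x + c x.swap = 1) (hsymm : ∀ x : ℕ × ℕ, f x.swap = f x)
    (hUV : ∀ x : ℕ × ℕ, f x * c x = U x + V x.swap) (hU : Summable U) :
    Summable V ∧ ∑' x, f x = 2 * (∑' x, U x + ∑' x, V x) := by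
  have hg : Summable fun x => f x * c x := hf.norm.of_norm_bounded fun x => by
    rw [norm_mul]
    exact mul_le_of_le_one_right (norm_nonneg _) (hc x)
  have hV : Summable V := by
    have : Summable fun x : ℕ × ℕ => V x.swap :=
      (hg.sub hU).congr fun x => by rw [hUV, add_sub_cancel_left]
    exact this.prod_symm
  have hgsum : HasSum (fun x => f x * c x) (∑' x, U x + ∑' x, V x) := by
    have h1 := hU.hasSum.add hV.prod_symm.hasSum
    rw [show ∑' x : ℕ × ℕ, V x.swap = ∑' x, V x from (Equiv.prodComm ℕ ℕ).tsum_eq V] at h1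
    simpa only [hUV] using h1
  have h1 : HasSum (fun x : ℕ × ℕ => f x.swap * c x.swap) (∑' x, U x + ∑' x, V x) :=
    (Equiv.prodComm ℕ ℕ).hasSum_iff.2 hgsum
  refine ⟨hV, ?_⟩
  have h2 := hgsum.add h1
  simp only [hsymm, ← mul_add, hc1, mul_one] at h2
  rw [h2.tsum_eq]
  ring

/-- The double series as a sum of two families of sums over horizontal lines. -/
theorem hasSum_sub_one_mul_doubleSeries {s w : ℂ} (hws : w ∈ regularW) (hs : 1 < s.re)
    (hw : 1 < w.re) {a b : ℕ → ℂ}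
    (ha : ∀ m : ℕ, HasSum (fun n : ℤ => regularFamily (n / (m + 1)) (s, w)) (a m))
    (hb : ∀ m : ℕ, HasSum (fun n : ℤ =>
      powFun (dualExponent (s, w)) (fun t => singularFamily t (s, w)) (n / (m + 1))) (b m)) :
    HasSum (fun m : ℕ => ((m : ℂ) + 1) ^ (-(2 * s)) * (a m + 2 * b m))
      ((w - 1) * doubleSeries s w) := by
  rw [show dualExponent (s, w) = 2 * s + w - 1 from rfl] at hb
  have hw1 : w ≠ 1 := fun h => by simp [h] at hw
  have hT := (hasSum_doubleSeries hs hw).mul_left (w - 1)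
  have hfs : Summable fun x : ℕ × ℕ => (w - 1) * latticeTerm s w (x.1 + 1) (x.2 + 1) := by
    have := hT.summable.comp_injective (i := fun x : ℕ × ℕ => (x.1, x.2 + 1))
      (fun x y h => by simpa [Prod.ext_iff] using h)
    refine this.congr fun x => ?_
    simp
  have hUs := summable_regular_part (p := (s, w)) ⟨mem_univ _, hws⟩ hs
  obtain ⟨hVs, hsum⟩ := tsum_eq_of_partition
    (c := fun x => cutoff ((x.2 + 1) / (x.1 + 1)))
    (V := fun x : ℕ × ℕ => ((x.1 : ℂ) + 1) ^ (-(2 * s)) *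
      powFun (2 * s + w - 1) (fun t => singularFamily t (s, w)) ((x.2 + 1) / (x.1 + 1)))
    hfs (fun x => norm_cutoff_le _) (fun x => by
      have h2 := cutoff_add_cutoff_inv (t := ((x.2 : ℝ) + 1) / (x.1 + 1)) (by positivity)
      rw [inv_div] at h2
      simp only [Prod.fst_swap, Prod.snd_swap]
      exact_mod_cast h2) (fun x => by
      simp only [Prod.fst_swap, Prod.snd_swap]
      rw [latticeTerm_symm s w (by positivity) (by positivity)]) (fun x => by
      have := sub_one_mul_latticeTerm_mul_cutoff s hws (x := x.1 + 1) (y := x.2 + 1)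
        (by positivity) (by positivity)
      simp only [Prod.fst_swap, Prod.snd_swap]
      exact_mod_cast this) hUs
  have hrow : HasSum (fun m : ℕ => ∑' n : ℕ, (w - 1) * latticeTerm s w (m + 1) n)
      ((w - 1) * doubleSeries s w) :=
    hT.prod_fiberwise fun m => (hT.summable.prod_factor m).hasSum
  have hfrow : HasSum (fun m : ℕ => ∑' n : ℕ, (w - 1) * latticeTerm s w (m + 1) (n + 1)) _ :=
    hfs.hasSum.prod_fiberwise fun m => (hfs.prod_factor m).hasSum
  have hUrow : HasSum (fun m : ℕ => ∑' n : ℕ,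
      ((m : ℂ) + 1) ^ (-(2 * s)) * regularFamily ((n + 1) / (m + 1)) (s, w)) _ :=
    hUs.hasSum.prod_fiberwise fun m => (hUs.prod_factor m).hasSum
  have hVrow : HasSum (fun m : ℕ => ∑' n : ℕ, ((m : ℂ) + 1) ^ (-(2 * s)) *
      powFun (2 * s + w - 1) (fun t => singularFamily t (s, w)) ((n + 1) / (m + 1))) _ :=
    hVs.hasSum.prod_fiberwise fun m => (hVs.prod_factor m).hasSum
  have key := (hrow.sub hfrow).add ((hUrow.add hVrow).mul_left 2)
  rw [hsum, sub_add_cancel] at key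
  have hrowz : ∀ m : ℕ, ∑' n : ℕ, (w - 1) * latticeTerm s w (m + 1) n =
      ((m : ℂ) + 1) ^ (-(2 * s)) * regularFamily 0 (s, w) +
        ∑' n : ℕ, (w - 1) * latticeTerm s w (m + 1) (n + 1) := by
    intro m
    have e3 : ∑' n : ℕ, (w - 1) * latticeTerm s w (m + 1) n = _ :=
      (hT.summable.prod_factor m).tsum_eq_zero_add
    have e4 := sub_one_mul_latticeTerm_zero s hw1 (x := (m : ℝ) + 1) (by positivity)
    rw [e3, Nat.cast_zero, e4]
    push_cast
    rfl
  refine HasSum.congr_fun key fun m => ?_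
  have e1 := tsum_int_even (f := fun t => regularFamily t (s, w)) (y := (m : ℝ) + 1)
    (fun t => regularFamily_neg t (s, w)) (ha m)
  have e2 := tsum_int_half_line (fun t ht => by rw [powFun, if_neg ht.not_gt]) (by positivity)
    (hb m)
  rw [e1, e2, hrowz, tsum_mul_left (a := ((m : ℂ) + 1) ^ (-(2 * s))),
    tsum_mul_left (a := ((m : ℂ) + 1) ^ (-(2 * s)))]
  ring
end
section
open MeasureTheory Filter Topology Set
open scoped Real ContDiff

/-! ### The continuation obtained from the Euler–Maclaurin formula -/

theorem differentiable_dualExponent : Differentiable ℂ dualExponent := by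
  unfold dualExponent
  fun_prop

theorem re_dualExponent (p : ℂ × ℂ) : (dualExponent p).re = 2 * p.1.re + p.2.re - 1 := by
  simp [dualExponent]

/-- The remainder integral of the regular part on a horizontal line. -/
noncomputable def regularTail (K m : ℕ) (p : ℂ × ℂ) : ℂ :=
  ∫ t, (bernoulliKernel (K + 1) ((m + 1) * t) : ℂ) * derivIter regularFamily (K + 1) t p

/-- The remainder integral of the singular part on a horizontal line. -/
noncomputable def singularTail (K m : ℕ) (p : ℂ × ℂ) : ℂ :=
  ∫ v, (bernoulliKernel (K + 1) ((m + 1) * v) : ℂ) *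
    powFun (dualExponent p + (K + 1 : ℕ))
      (fun t => powIter dualExponent singularFamily (K + 1) t p) v

/-- The product of the linear forms that vanish on the oblique polar lines. -/
noncomputable def poleProd (K : ℕ) (p : ℂ × ℂ) : ℂ :=
  ∏ j ∈ Finset.range K, (dualExponent p - 1 + j)

/-- The main term of the Euler–Maclaurin formula, cleared of denominators. -/
noncomputable def mainPart (K : ℕ) (p : ℂ × ℂ) : ℂ :=
  riemannZeta₁ (2 * p.1 - 1) / 2 * (poleProd K p * (∫ t, regularFamily t p) +
    2 * ((-1) ^ K * ∫ v, powFun (dualExponent p + K) (fun t => derivIter singularFamily K t p) v))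

/-- The sum of the remainder terms. -/
noncomputable def tailSum (K : ℕ) (p : ℂ × ℂ) : ℂ :=
  ∑' m : ℕ, ((m : ℂ) + 1) ^ (-(2 * p.1 + K)) * (regularTail K m p + 2 * singularTail K m p)

/-- The continuation of `(s - 1) (w - 1) (poleProd K) D(s, w)`. -/
noncomputable def clearedSeries (K : ℕ) (p : ℂ × ℂ) : ℂ :=
  mainPart K p + (p.1 - 1) * poleProd K p * ((-1) ^ K * tailSum K p)

/-- The region where the Euler–Maclaurin formula of order `K` applies. -/
def tailDomain (K : ℕ) : Set (ℂ × ℂ) :=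
  paramDomain ∩ {p | 1 < (2 * p.1 + K).re} ∩ {p | 1 < (dualExponent p + K).re}

theorem isOpen_tailDomain (K : ℕ) : IsOpen (tailDomain K) := by
  refine (isOpen_paramDomain.inter (isOpen_lt continuous_const ?_)).inter
    (isOpen_lt continuous_const ?_)
  · fun_prop
  · exact Complex.continuous_re.comp (differentiable_dualExponent.continuous.add continuous_const)

theorem measurable_bernoulliKernel_mul (K m : ℕ) :
    Measurable fun t : ℝ => (bernoulliKernel (K + 1) ((m + 1) * t) : ℂ) :=
  Complex.measurable_ofReal.comp ((measurable_bernoulliKernel _).comp (measurable_const_mul _))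

theorem differentiable_poleProd (K : ℕ) : Differentiable ℂ (poleProd K) := by
  have h : Differentiable ℂ fun z : ℂ => ∏ j ∈ Finset.range K, (z - 1 + (j : ℂ)) :=
    Differentiable.fun_finsetProd fun j _ => (differentiable_id.sub_const 1).add_const (j : ℂ)
  exact h.comp differentiable_dualExponent

theorem differentiableOn_regularTail (K m : ℕ) :
    DifferentiableOn ℂ (regularTail K m) paramDomain := by
  obtain ⟨C, -, hC⟩ := exists_bound_bernoulliKernel (K + 1)
  exact (isTestFamily_derivIter isTestFamily_regularFamily _).differentiableOn_integral
    isOpen_paramDomain (measurable_bernoulliKernel_mul K m) fun t => by simpa using hC ((m + 1) * t)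

theorem differentiableOn_singularTail (K m : ℕ) :
    DifferentiableOn ℂ (singularTail K m) (tailDomain K) := by
  obtain ⟨C, -, hC⟩ := exists_bound_bernoulliKernel (K + 1)
  refine ((isTestFamily_powIter isTestFamily_singularFamily differentiable_dualExponent
    (K + 1)).differentiableOn_integral_powFun (ν := fun p => dualExponent p + (K + 1 : ℕ))
    isOpen_paramDomain (differentiable_dualExponent.add_const _)
    (measurable_bernoulliKernel_mul K m) (M := C) fun t => by simpa using hC ((m + 1) * t)).mono ?_
  rintro p ⟨⟨h1, -⟩, h2⟩
  refine ⟨h1, ?_⟩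
  simp only [mem_ofPred_eq, add_re, natCast_re] at h2 ⊢
  push_cast
  linarith

theorem exists_bound_tail (K : ℕ) {p : ℂ × ℂ} (hp : p ∈ tailDomain K) :
    ∃ V ∈ 𝓝 p, ∃ C : ℝ, ∀ m : ℕ, ∀ q ∈ V, ‖regularTail K m q + 2 * singularTail K m q‖ ≤ C := by
  obtain ⟨M, hM0, hM⟩ := exists_bound_bernoulliKernel (K + 1)
  have hA := isTestFamily_derivIter isTestFamily_regularFamily (K + 1)
  have hB := isTestFamily_powIter isTestFamily_singularFamily differentiable_dualExponent (K + 1)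
  obtain ⟨V, hV, hVΩ, C, hC0, hC⟩ := hA.exists_bound isOpen_paramDomain hp.1.1
  obtain ⟨W, hW, -, b, hb, hWb⟩ := hB.exists_majorant isOpen_paramDomain
    (ν := fun p => dualExponent p + (K + 1 : ℕ))
    (differentiable_dualExponent.continuous.add continuous_const) hp.1.1 (by
      have := hp.2
      simp only [mem_ofPred_eq, add_re, natCast_re] at this ⊢
      push_cast
      linarith)
  refine ⟨V ∩ W, inter_mem hV hW, M * C * 4 + 2 * ∫ v, M * b v, fun m q hq => ?_⟩
  have h1 : ‖regularTail K m q‖ ≤ M * C * 4 :=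
    hA.norm_integral_le (hVΩ hq.1) (fun t => by simpa using hM ((m + 1) * t)) (hC q hq.1)
  have h2 : ‖singularTail K m q‖ ≤ ∫ v, M * b v := by
    refine norm_integral_le_of_norm_le (hb.const_mul M) (Eventually.of_forall fun v => ?_)
    rw [norm_mul]
    exact mul_le_mul (by simpa using hM ((m + 1) * v)) (hWb q hq.2 v) (norm_nonneg _) hM0
  calc _ ≤ ‖regularTail K m q‖ + ‖2 * singularTail K m q‖ := norm_add_le _ _
    _ ≤ _ := by
      rw [norm_mul, Complex.norm_two]
      gcongr

theorem norm_natCast_add_one_cpow (m : ℕ) (z : ℂ) : ‖((m : ℂ) + 1) ^ z‖ = ((m : ℝ) + 1) ^ z.re := by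
  rw [show ((m : ℂ) + 1) = ((m + 1 : ℝ) : ℂ) by push_cast; rfl,
    Complex.norm_cpow_eq_rpow_re_of_pos (by positivity)]

theorem exists_summable_bound_tail (K : ℕ) {p : ℂ × ℂ} (hp : p ∈ tailDomain K) :
    ∃ V ∈ 𝓝 p, ∃ b : ℕ → ℝ, Summable b ∧ ∀ m : ℕ, ∀ q ∈ V,
      ‖((m : ℂ) + 1) ^ (-(2 * q.1 + K)) * (regularTail K m q + 2 * singularTail K m q)‖ ≤ b m := by
  obtain ⟨V, hV, C, hC⟩ := exists_bound_tail K hp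
  have hp2 := hp.1.2
  rw [mem_ofPred_eq] at hp2
  obtain ⟨c, hc1, hc⟩ := exists_between hp2
  have hcont : Continuous fun q : ℂ × ℂ => (2 * q.1 + K).re := by fun_prop
  have h1 : ∀ᶠ q : ℂ × ℂ in 𝓝 p, c < (2 * q.1 + K).re :=
    hcont.continuousAt.eventually (lt_mem_nhds hc)
  refine ⟨_, inter_mem hV h1, _, (summable_add_one_rpow hc1).mul_right C, fun m q hq => ?_⟩
  have h0 : 0 ≤ (m : ℝ) := m.cast_nonneg
  rw [norm_mul, norm_natCast_add_one_cpow, neg_re]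
  have := hq.2
  rw [mem_ofPred_eq] at this
  refine mul_le_mul (Real.rpow_le_rpow_of_exponent_le (by linarith) (by linarith)) (hC m q hq.1)
    (norm_nonneg _) (by positivity)

theorem differentiableOn_tailSum (K : ℕ) : DifferentiableOn ℂ (tailSum K) (tailDomain K) := by
  refine differentiableOn_tsum_of_dominated (isOpen_tailDomain K) (fun m => ?_) fun p hp =>
    exists_summable_bound_tail K hp
  have h1 : Differentiable ℂ fun p : ℂ × ℂ => ((m : ℂ) + 1) ^ (-(2 * p.1 + K)) := by
    have h2 : ((m : ℂ) + 1) ≠ 0 := by exact_mod_cast m.succ_ne_zero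
    exact Differentiable.const_cpow (by fun_prop) (Or.inl h2)
  exact h1.differentiableOn.mul (((differentiableOn_regularTail K m).mono fun p hp => hp.1.1).add
    ((differentiableOn_singularTail K m).const_mul 2))

theorem differentiableOn_mainPart (K : ℕ) : DifferentiableOn ℂ (mainPart K) (tailDomain K) := by
  have h1 : DifferentiableOn ℂ (fun p => ∫ t, regularFamily t p) (tailDomain K) := by
    have := isTestFamily_regularFamily.differentiableOn_integral isOpen_paramDomain
      (h := fun _ => 1) measurable_const (M := 1) (fun t => by simp)
    simp only [one_mul] at this
    exact this.mono fun p hp => hp.1.1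
  have h2 : DifferentiableOn ℂ (fun p => ∫ v, powFun (dualExponent p + K)
      (fun t => derivIter singularFamily K t p) v) (tailDomain K) := by
    have := (isTestFamily_derivIter isTestFamily_singularFamily K).differentiableOn_integral_powFun
      isOpen_paramDomain (ν := fun p => dualExponent p + K)
      (differentiable_dualExponent.add_const _) (h := fun _ => 1) measurable_const
      (M := 1) (fun t => by simp)
    simp only [one_mul] at this
    exact this.mono fun p hp => ⟨hp.1.1, hp.2⟩
  have h3 : Differentiable ℂ fun p : ℂ × ℂ => riemannZeta₁ (2 * p.1 - 1) :=
    differentiable_riemannZeta₁.comp (by fun_prop)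
  have h4 : DifferentiableOn ℂ (fun p : ℂ × ℂ => riemannZeta₁ (2 * p.1 - 1) / 2)
      (tailDomain K) := by
    simp only [div_eq_mul_inv]
    exact h3.differentiableOn.mul_const _
  exact h4.mul (((differentiable_poleProd K).differentiableOn.mul
    h1).add ((h2.const_mul _).const_mul 2))

theorem differentiableOn_clearedSeries (K : ℕ) :
    DifferentiableOn ℂ (clearedSeries K) (tailDomain K) :=
  (differentiableOn_mainPart K).add (((differentiable_fst.sub_const 1).mul
    (differentiable_poleProd K)).differentiableOn.mul ((differentiableOn_tailSum K).const_mul _))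

theorem hasSum_regularFamily_line (K m : ℕ) {p : ℂ × ℂ} (hp : p ∈ paramDomain) :
    HasSum (fun n : ℤ => regularFamily (n / (m + 1)) p)
      (((m : ℂ) + 1) * (∫ t, regularFamily t p) +
        (-1) ^ K * ((m : ℂ) + 1) ^ (-(K : ℤ)) * regularTail K m p) := by
  have h := hasSum_euler_maclaurin_scaled (f := fun k t => derivIter regularFamily k t p)
    (fun k x => (isTestFamily_derivIter isTestFamily_regularFamily k).1.hasDerivAt hp x)
    (fun k => (isTestFamily_derivIter isTestFamily_regularFamily k).integrable hp) K
    (y := (m : ℝ) + 1) (by positivity)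
  push_cast at h
  exact h

theorem hasSum_singularFamily_line (K m : ℕ) {p : ℂ × ℂ} (hp : p ∈ paramDomain)
    (h1 : 1 < (dualExponent p).re) :
    HasSum (fun n : ℤ => powFun (dualExponent p) (fun t => singularFamily t p) (n / (m + 1)))
      (((m : ℂ) + 1) * (∫ v, powFun (dualExponent p) (fun t => singularFamily t p) v) +
        (-1) ^ K * ((m : ℂ) + 1) ^ (-(K : ℤ)) * singularTail K m p) := by
  have hB := isTestFamily_powIter isTestFamily_singularFamily differentiable_dualExponent
  have h := hasSum_euler_maclaurin_scaled
    (f := fun k => powFun (dualExponent p + k) fun t => powIter dualExponent singularFamily k t p)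
    (fun k x => hasDerivAt_powFun_powIter isTestFamily_singularFamily differentiable_dualExponent
      hp k x)
    (fun k => (hB k).integrable_powFun isOpen_paramDomain hp (by
      rw [add_re, natCast_re]
      linarith [k.cast_nonneg (α := ℝ)])) K
    (y := (m : ℝ) + 1) (by positivity)
  simp only [Nat.cast_zero, add_zero] at h
  push_cast at h
  unfold singularTail
  push_cast
  exact h

theorem clearedSeries_eq (K : ℕ) {s w : ℂ} (hws : w ∈ regularW) (hs : 1 < s.re) (hw : 1 < w.re) :
    clearedSeries K (s, w) = (s - 1) * (w - 1) * poleProd K (s, w) * doubleSeries s w := by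
  have hp : (s, w) ∈ paramDomain := ⟨mem_univ _, hws⟩
  have hν : 1 < (dualExponent (s, w)).re := by
    rw [re_dualExponent]
    simp only
    linarith
  have hK : 0 ≤ (K : ℝ) := K.cast_nonneg
  have hpK : (s, w) ∈ tailDomain K := by
    refine ⟨⟨hp, ?_⟩, ?_⟩
    · simp
      linarith
    · rw [mem_ofPred_eq, add_re, natCast_re]
      linarith
  have hla := fun m => hasSum_regularFamily_line K m hp
  have hlb := fun m => hasSum_singularFamily_line K m hp hν
  have hsum := hasSum_sub_one_mul_doubleSeries hws hs hw hla hlb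
  set a := ∫ t, regularFamily t (s, w)
  set b := ∫ v, powFun (dualExponent (s, w)) (fun t => singularFamily t (s, w)) v with hb
  have hζ : HasSum (fun m : ℕ => ((m : ℂ) + 1) ^ (-(2 * s)) * (((m : ℂ) + 1) * (a + 2 * b)))
      (riemannZeta (2 * s - 1) * (a + 2 * b)) := by
    have h1 : 1 < (2 * s - 1).re := by
      simp
      linarith
    have h2 : Summable fun m : ℕ => ((m : ℂ) + 1) ^ (-(2 * s - 1)) :=
      (summable_add_one_rpow h1).of_norm_bounded fun m => by
        rw [norm_natCast_add_one_cpow, neg_re]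
    have h3 : HasSum (fun m : ℕ => ((m : ℂ) + 1) ^ (-(2 * s - 1))) (riemannZeta (2 * s - 1)) := by
      rw [zeta_eq_tsum_one_div_nat_add_one_cpow h1]
      simp only [one_div, ← Complex.cpow_neg]
      exact h2.hasSum
    refine (h3.mul_right (a + 2 * b)).congr_fun fun m => ?_
    have hm : (m : ℂ) + 1 ≠ 0 := by exact_mod_cast m.succ_ne_zero
    rw [show -(2 * s - 1) = -(2 * s) + 1 by ring, Complex.cpow_add _ _ hm, Complex.cpow_one]
    ring
  have htail : HasSum (fun m : ℕ => (-1) ^ K * (((m : ℂ) + 1) ^ (-(2 * s + K)) *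
      (regularTail K m (s, w) + 2 * singularTail K m (s, w)))) ((-1) ^ K * tailSum K (s, w)) := by
    obtain ⟨V, hV, b, hb, h⟩ := exists_summable_bound_tail K hpK
    exact (hb.of_norm_bounded fun m => h m _ (mem_of_mem_nhds hV)).hasSum.mul_left _
  have hD : (w - 1) * doubleSeries s w =
      riemannZeta (2 * s - 1) * (a + 2 * b) + (-1) ^ K * tailSum K (s, w) := by
    refine hsum.unique ((hζ.add htail).congr_fun fun m => ?_)
    have hm : (m : ℂ) + 1 ≠ 0 := by exact_mod_cast m.succ_ne_zero
    rw [show -(2 * s + K) = -(2 * s) + ((-(K : ℤ) : ℤ) : ℂ) by push_cast; ring,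
      Complex.cpow_add _ _ hm, Complex.cpow_intCast]
    ring
  have hz : (s - 1) * riemannZeta (2 * s - 1) = riemannZeta₁ (2 * s - 1) / 2 := by
    have h2 : s ≠ 1 := fun h => by simp [h] at hs
    have h1 : 2 * s - 1 ≠ 1 := fun h => h2 (by linear_combination h / 2)
    rw [riemannZeta_eq_inv_sub_mul h1]
    have h3 : s - 1 ≠ 0 := sub_ne_zero.2 h2
    rw [show 2 * s - 1 - 1 = 2 * (s - 1) by ring]
    field_simp
  have hM := prod_mul_integral_powFun isOpen_paramDomain isTestFamily_singularFamily hp hν K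
  rw [← hb] at hM
  unfold clearedSeries mainPart
  simp only
  rw [← hM, ← hz]
  unfold poleProd
  linear_combination -(s - 1) * (∏ j ∈ Finset.range K, (dualExponent (s, w) - 1 + j)) * hD
end
section
open MeasureTheory Filter Topology Set
open scoped Real ContDiff

/-! ### Extension across the lines `w = 2, 3, 4, …` -/

theorem differentiableOn_doubleSeries {s : ℂ} (hs : 1 < s.re) :
    DifferentiableOn ℂ (doubleSeries s) {w | 1 < w.re} := by
  intro w hw
  obtain ⟨c, hc1, hc⟩ := exists_between (show 1 < w.re from hw)
  have hopen : IsOpen {w : ℂ | c < w.re} := isOpen_lt continuous_const Complex.continuous_re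
  have hsum := (summable_doubleSeries hs (w := c) (by simpa using hc1)).norm
  have hd : DifferentiableOn ℂ (fun w => ∑' n : {n : ℤ // n ≠ 0},
      heckeL n.1 s * ((n.1.natAbs : ℕ) : ℂ) ^ (-w)) {w : ℂ | c < w.re} := by
    refine differentiableOn_tsum_of_summable_norm hsum (fun n => ?_) hopen fun n w hw => ?_
    · have h0 : ((n.1.natAbs : ℕ) : ℂ) ≠ 0 := by exact_mod_cast Int.natAbs_ne_zero.2 n.2
      exact ((differentiable_id.neg.const_cpow (Or.inl h0)).const_mul _).differentiableOn
    · rw [norm_mul, norm_mul, norm_natAbs_cpow, norm_natAbs_cpow]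
      have h1 : (1 : ℝ) ≤ |(n.1 : ℝ)| := by exact_mod_cast Int.one_le_abs n.2
      have hw' : c ≤ w.re := le_of_lt hw
      exact mul_le_mul_of_nonneg_left
        (Real.rpow_le_rpow_of_exponent_le h1 (by simpa using hw')) (norm_nonneg _)
  exact ((hd.differentiableAt (hopen.mem_nhds hc)).const_add _).differentiableWithinAt

/-- The product of the linear forms that vanish on the polar lines. -/
noncomputable def poleDenom (K : ℕ) (p : ℂ × ℂ) : ℂ := (p.1 - 1) * (p.2 - 1) * poleProd K p

theorem differentiable_poleDenom (K : ℕ) : Differentiable ℂ (poleDenom K) :=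
  ((differentiable_fst.sub_const 1).mul (differentiable_snd.sub_const 1)).mul
    (differentiable_poleProd K)

/-- The Cauchy integral of the cleared series over a circle of radius `1 / 2` around `w₀`. -/
noncomputable def cauchySeries (K : ℕ) (w₀ : ℂ) (p : ℂ × ℂ) : ℂ :=
  (2 * π * I : ℂ)⁻¹ • ∮ ζ in C(w₀, 1 / 2), (ζ - p.2)⁻¹ • clearedSeries K (p.1, ζ)

/-- The cleared series, extended across the lines `w = 2, 3, 4, …`. -/
noncomputable def extendedSeries (K : ℕ) (p : ℂ × ℂ) : ℂ :=
  open Classical in if p.2 ∈ regularW then clearedSeries K p else cauchySeries K p.2 p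

/-- The domain of the extended series. -/
def extendedDomain (K : ℕ) : Set (ℂ × ℂ) :=
  {p | 1 < (2 * p.1 + K).re} ∩ {p | 1 < (dualExponent p + K).re}

theorem isOpen_extendedDomain (K : ℕ) : IsOpen (extendedDomain K) := by
  refine (isOpen_lt continuous_const ?_).inter (isOpen_lt continuous_const ?_)
  · fun_prop
  · exact Complex.continuous_re.comp (differentiable_dualExponent.continuous.add continuous_const)

theorem mem_extendedDomain {K : ℕ} {p : ℂ × ℂ} :
    p ∈ extendedDomain K ↔ 1 < 2 * p.1.re + K ∧ 2 < 2 * p.1.re + p.2.re + K := by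
  simp only [extendedDomain, mem_inter_iff, mem_ofPred_eq, add_re, natCast_re, re_dualExponent,
    Complex.mul_re, Complex.re_ofNat, Complex.im_ofNat, zero_mul, sub_zero]
  constructor <;> rintro ⟨h1, h2⟩ <;> exact ⟨h1, by linarith⟩

theorem convex_extendedDomain (K : ℕ) : Convex ℝ (extendedDomain K) := by
  rintro p hp q hq a b ha hb hab
  rw [mem_extendedDomain] at *
  simp only [Prod.fst_add, Prod.smul_fst, Prod.snd_add, Prod.smul_snd, add_re, real_smul,
    re_ofReal_mul]
  obtain rfl : b = 1 - a := by linarith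
  rcases ha.eq_or_lt with rfl | ha
  · constructor <;> nlinarith
  · constructor <;> nlinarith

theorem mem_tailDomain_of_regular {K : ℕ} {p : ℂ × ℂ} (hp : p ∈ extendedDomain K)
    (hw : p.2 ∈ regularW) : p ∈ tailDomain K := ⟨⟨⟨mem_univ _, hw⟩, hp.1⟩, hp.2⟩

theorem mem_regularW_of_dist {k : ℕ} {w : ℂ} (hw : ‖w - (k + 2)‖ < 1) (hne : w ≠ k + 2) :
    w ∈ regularW := by
  rintro n rfl
  have h : ‖(((n : ℤ) - k : ℤ) : ℂ)‖ < 1 := by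
    convert hw using 2
    push_cast
    ring
  rw [Complex.norm_intCast] at h
  have h1 : |(n : ℤ) - k| < 1 := by exact_mod_cast h
  have h2 : (n : ℤ) = k := by
    have := Int.abs_lt_one_iff.1 h1
    omega
  exact hne (by rw [show n = k by exact_mod_cast h2])

theorem re_of_mem_closedBall {k : ℕ} {w : ℂ} (hw : w ∈ Metric.closedBall ((k : ℂ) + 2) (1 / 2)) :
    3 / 2 ≤ w.re := by
  rw [mem_closedBall_iff_norm] at hw
  have h1 := (abs_le.1 ((Complex.abs_re_le_norm _).trans hw)).1
  simp at h1
  linarith [k.cast_nonneg (α := ℝ)]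

theorem mem_tailDomain_of_mem_sphere {K k : ℕ} {s w : ℂ} (hs : 1 < 2 * s.re + K)
    (hw : w ∈ Metric.sphere ((k : ℂ) + 2) (1 / 2)) : (s, w) ∈ tailDomain K := by
  have h1 := re_of_mem_closedBall (Metric.sphere_subset_closedBall hw)
  rw [mem_sphere_iff_norm] at hw
  refine mem_tailDomain_of_regular (mem_extendedDomain.2 ⟨hs, ?_⟩)
    (mem_regularW_of_dist (k := k) (by rw [hw]; norm_num) ?_)
  · simp only
    linarith
  · intro h
    rw [show w = k + 2 from h, sub_self, norm_zero] at hw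
    norm_num at hw

theorem cauchySeries_eq_of_one_lt (K k : ℕ) {s w : ℂ} (hs : 1 < s.re)
    (hw : w ∈ Metric.ball ((k : ℂ) + 2) (1 / 2)) :
    cauchySeries K (k + 2) (s, w) = poleDenom K (s, w) * doubleSeries s w := by
  have hd : DifferentiableOn ℂ (fun w => poleDenom K (s, w) * doubleSeries s w) {w | 1 < w.re} := by
    refine DifferentiableOn.mul ?_ (differentiableOn_doubleSeries hs)
    exact ((differentiable_poleDenom K).comp
      ((differentiable_const s).prodMk differentiable_id)).differentiableOn
  have hd2 : DiffContOnCl ℂ (fun w => poleDenom K (s, w) * doubleSeries s w)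
      (Metric.ball ((k : ℂ) + 2) (1 / 2)) := by
    refine DifferentiableOn.diffContOnCl (hd.mono fun z hz => ?_)
    have := re_of_mem_closedBall (Metric.closure_ball_subset_closedBall hz)
    rw [mem_ofPred_eq]
    linarith
  rw [← hd2.two_pi_i_inv_smul_circleIntegral_sub_inv_smul hw, cauchySeries]
  congr 1
  refine circleIntegral.integral_congr (by norm_num) fun z hz => ?_
  have h1 := (mem_tailDomain_of_mem_sphere (K := K) (s := s)
    (by linarith [K.cast_nonneg (α := ℝ)]) hz).1.1.2
  have h2 := re_of_mem_closedBall (Metric.sphere_subset_closedBall hz)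
  simp only
  rw [clearedSeries_eq K h1 hs (by linarith), poleDenom]

theorem differentiableOn_cauchySeries (K k : ℕ) : DifferentiableOn ℂ (cauchySeries K (k + 2))
    ({s : ℂ | 1 < 2 * s.re + K} ×ˢ Metric.ball ((k : ℂ) + 2) (1 / 2)) := by
  have hcont : Continuous fun s : ℂ => 2 * s.re + K := by fun_prop
  have hS : IsOpen {s : ℂ | 1 < 2 * s.re + K} := isOpen_lt continuous_const hcont
  have hH : ContinuousOn (clearedSeries K)
      ({s : ℂ | 1 < 2 * s.re + K} ×ˢ Metric.sphere ((k : ℂ) + 2) (1 / 2)) :=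
    (differentiableOn_clearedSeries K).continuousOn.mono fun p hp =>
      mem_tailDomain_of_mem_sphere hp.1 hp.2
  have hmem : ∀ θ, circleMap ((k : ℂ) + 2) (1 / 2) θ ∈ Metric.sphere ((k : ℂ) + 2) (1 / 2) :=
    fun θ => circleMap_mem_sphere _ (by norm_num) θ
  have hne : ∀ w ∈ Metric.ball ((k : ℂ) + 2) (1 / 2), ∀ θ,
      circleMap ((k : ℂ) + 2) (1 / 2) θ - w ≠ 0 := fun w hw θ =>
    sub_ne_zero.2 (circleMap_ne_mem_ball hw θ)
  have hcontc : ContinuousOn (fun x : (ℂ × ℂ) × ℝ =>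
      deriv (circleMap ((k : ℂ) + 2) (1 / 2)) x.2 •
        ((circleMap ((k : ℂ) + 2) (1 / 2) x.2 - x.1.2)⁻¹ •
          clearedSeries K (x.1.1, circleMap ((k : ℂ) + 2) (1 / 2) x.2)))
      (({s : ℂ | 1 < 2 * s.re + K} ×ˢ Metric.ball ((k : ℂ) + 2) (1 / 2)) ×ˢ univ) := by
    have hc := continuous_circleMap ((k : ℂ) + 2) (1 / 2)
    have c1 : Continuous fun x : (ℂ × ℂ) × ℝ => deriv (circleMap ((k : ℂ) + 2) (1 / 2)) x.2 := by
      simp only [deriv_circleMap]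
      fun_prop
    have c2 : ContinuousOn (fun x : (ℂ × ℂ) × ℝ =>
        (circleMap ((k : ℂ) + 2) (1 / 2) x.2 - x.1.2)⁻¹)
        (({s : ℂ | 1 < 2 * s.re + K} ×ˢ Metric.ball ((k : ℂ) + 2) (1 / 2)) ×ˢ univ) :=
      ContinuousOn.inv₀ (by fun_prop) fun x hx => hne _ hx.1.2 _
    have c3 : ContinuousOn (fun x : (ℂ × ℂ) × ℝ =>
        clearedSeries K (x.1.1, circleMap ((k : ℂ) + 2) (1 / 2) x.2))
        (({s : ℂ | 1 < 2 * s.re + K} ×ˢ Metric.ball ((k : ℂ) + 2) (1 / 2)) ×ˢ univ) :=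
      hH.comp (f := fun x : (ℂ × ℂ) × ℝ => (x.1.1, circleMap ((k : ℂ) + 2) (1 / 2) x.2))
        (by fun_prop) fun x hx => ⟨hx.1.1, hmem _⟩
    exact c1.continuousOn.smul (c2.smul c3)
  have hopen := hS.prod (Metric.isOpen_ball (x := (k : ℂ) + 2) (ε := 1 / 2))
  refine DifferentiableOn.fun_const_smul ?_ _
  simp only [circleIntegral, intervalIntegral.integral_of_le Real.two_pi_pos.le]
  refine differentiableOn_integral_of_dominated hopen (fun p hp => ?_)
    (Eventually.of_forall fun θ => ?_) fun p hp => ?_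
  · exact (hcontc.comp_continuous (f := fun θ : ℝ => (p, θ)) (by fun_prop)
      fun θ => ⟨hp, mem_univ _⟩).aestronglyMeasurable
  · have d1 : DifferentiableOn ℂ (fun p : ℂ × ℂ => (circleMap ((k : ℂ) + 2) (1 / 2) θ - p.2)⁻¹)
        ({s : ℂ | 1 < 2 * s.re + K} ×ˢ Metric.ball ((k : ℂ) + 2) (1 / 2)) :=
      DifferentiableOn.fun_inv (by fun_prop) fun p hp => hne _ hp.2 θ
    have d2 : DifferentiableOn ℂ
        (fun p : ℂ × ℂ => clearedSeries K (p.1, circleMap ((k : ℂ) + 2) (1 / 2) θ))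
        ({s : ℂ | 1 < 2 * s.re + K} ×ˢ Metric.ball ((k : ℂ) + 2) (1 / 2)) :=
      (differentiableOn_clearedSeries K).comp (t := tailDomain K)
        (f := fun p : ℂ × ℂ => (p.1, circleMap ((k : ℂ) + 2) (1 / 2) θ)) (by fun_prop)
        fun p hp => mem_tailDomain_of_mem_sphere hp.1 (hmem θ)
    exact (d1.smul d2).const_smul (deriv (circleMap ((k : ℂ) + 2) (1 / 2)) θ)
  · obtain ⟨r, hr, hball⟩ := Metric.nhds_basis_closedBall.mem_iff.1 (hopen.mem_nhds hp)
    obtain ⟨C, hC⟩ := ((isCompact_closedBall p r).prod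
      (isCompact_Icc (a := (0 : ℝ)) (b := 2 * π))).exists_bound_of_continuousOn
      (hcontc.mono (prod_mono hball (subset_univ _)))
    refine ⟨_, Metric.closedBall_mem_nhds p hr, fun _ => C, integrable_const _, ?_⟩
    filter_upwards [ae_restrict_mem measurableSet_Ioc] with θ hθ q hq
    exact hC (q, θ) ⟨hq, Ioc_subset_Icc_self hθ⟩

theorem cauchySeries_eq_clearedSeries (K k : ℕ) {s w : ℂ} (hs : 1 < 2 * s.re + K)
    (hw : w ∈ Metric.ball ((k : ℂ) + 2) (1 / 2)) (hne : w ≠ k + 2) :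
    cauchySeries K (k + 2) (s, w) = clearedSeries K (s, w) := by
  have hcont : Continuous fun s : ℂ => 2 * s.re + K := by fun_prop
  have hS : IsOpen {s : ℂ | 1 < 2 * s.re + K} := isOpen_lt continuous_const hcont
  have hconv : Convex ℝ {s : ℂ | 1 < 2 * s.re + K} := by
    intro a ha b hb x y hx hy hxy
    simp only [mem_ofPred_eq, add_re, real_smul, re_ofReal_mul] at *
    obtain rfl : y = 1 - x := by linarith
    rcases hx.eq_or_lt with rfl | hx <;> nlinarith
  have hwr : w ∈ regularW := mem_regularW_of_dist (by
    rw [mem_ball_iff_norm] at hw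
    linarith) hne
  have hre := re_of_mem_closedBall (Metric.ball_subset_closedBall hw)
  have h1 : AnalyticOnNhd ℂ (fun s => cauchySeries K (k + 2) (s, w))
      {s : ℂ | 1 < 2 * s.re + K} := by
    refine DifferentiableOn.analyticOnNhd ?_ hS
    exact (differentiableOn_cauchySeries K k).comp (f := fun s : ℂ => (s, w)) (by fun_prop)
      fun s hs => ⟨hs, hw⟩
  have h2 : AnalyticOnNhd ℂ (fun s => clearedSeries K (s, w)) {s : ℂ | 1 < 2 * s.re + K} := by
    refine DifferentiableOn.analyticOnNhd ?_ hS
    refine (differentiableOn_clearedSeries K).comp (f := fun s : ℂ => (s, w)) (by fun_prop)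
      fun s hs => mem_tailDomain_of_regular (mem_extendedDomain.2 ⟨hs, ?_⟩) hwr
    simp only [mem_ofPred_eq] at hs ⊢
    linarith
  have hK : 0 ≤ (K : ℝ) := K.cast_nonneg
  refine h1.eqOn_of_preconnected_of_eventuallyEq h2 hconv.isPreconnected
    (z₀ := 2) (by simp; linarith) ?_ hs
  have hopen : IsOpen {s : ℂ | 1 < s.re} := isOpen_lt continuous_const Complex.continuous_re
  filter_upwards [hopen.mem_nhds (show (2 : ℂ) ∈ {s : ℂ | 1 < s.re} by simp)] with s hs
  rw [cauchySeries_eq_of_one_lt K k hs hw, clearedSeries_eq K hwr hs (by linarith), poleDenom]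

theorem differentiableOn_extendedSeries (K : ℕ) :
    DifferentiableOn ℂ (extendedSeries K) (extendedDomain K) := by
  intro p hp
  refine DifferentiableAt.differentiableWithinAt ?_
  by_cases hw : p.2 ∈ regularW
  · have h := ((differentiableOn_clearedSeries K).differentiableAt
      ((isOpen_tailDomain K).mem_nhds (mem_tailDomain_of_regular hp hw)))
    refine h.congr_of_eventuallyEq ?_
    filter_upwards [(isOpen_regularW.preimage continuous_snd).mem_nhds hw] with q hq
    exact if_pos hq
  · obtain ⟨k, hk⟩ : ∃ k : ℕ, p.2 = k + 2 := by
      by_contra! h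
      exact hw h
    have hnhds : ({s : ℂ | 1 < 2 * s.re + K} ×ˢ Metric.ball ((k : ℂ) + 2) (1 / 2)) ∈ 𝓝 p := by
      have hcont : Continuous fun s : ℂ => 2 * s.re + K := by fun_prop
      refine ((isOpen_lt continuous_const hcont).prod Metric.isOpen_ball).mem_nhds
        ⟨(mem_extendedDomain.1 hp).1, ?_⟩
      rw [hk]
      exact Metric.mem_ball_self (by norm_num)
    refine ((differentiableOn_cauchySeries K k).differentiableAt hnhds).congr_of_eventuallyEq ?_
    filter_upwards [hnhds] with q hq
    unfold extendedSeries
    split_ifs with h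
    · exact (cauchySeries_eq_clearedSeries K k hq.1 hq.2 (h k)).symm
    · obtain ⟨n, hn⟩ : ∃ n : ℕ, q.2 = n + 2 := by
        by_contra! h'
        exact h h'
      by_cases hqk : q.2 = k + 2
      · rw [hqk]
      · exact absurd (mem_regularW_of_dist (by
          have := mem_ball_iff_norm.1 hq.2
          linarith) hqk) h

theorem extendedSeries_eq (K : ℕ) {s w : ℂ} (hs : 1 < s.re) (hw : 1 < w.re) :
    extendedSeries K (s, w) = poleDenom K (s, w) * doubleSeries s w := by
  unfold extendedSeries
  split_ifs with h
  · rw [clearedSeries_eq K h hs hw, poleDenom]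
  · obtain ⟨k, rfl⟩ : ∃ k : ℕ, w = k + 2 := by
      by_contra! h'
      exact h h'
    exact cauchySeries_eq_of_one_lt K k hs (Metric.mem_ball_self (by norm_num))
end
section
open Filter Topology Set

/-! ### Gluing -/

theorem poleProd_eq_mul {K K' : ℕ} (h : K ≤ K') (p : ℂ × ℂ) :
    poleProd K' p = poleProd K p * ∏ j ∈ Finset.Ico K K', (dualExponent p - 1 + j) :=
  (Finset.prod_range_mul_prod_Ico _ h).symm

theorem poleDenom_ne_zero {K : ℕ} {p : ℂ × ℂ} (hp : p ∉ polarLines) : poleDenom K p ≠ 0 := by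
  simp only [polarLines, mem_ofPred_eq, not_or, not_exists] at hp
  obtain ⟨h1, h2, h3⟩ := hp
  refine mul_ne_zero (mul_ne_zero (sub_ne_zero.2 h1) (sub_ne_zero.2 fun h => h2 0 (by simp [h])))
    (Finset.prod_ne_zero_iff.2 fun j _ h => h3 j ?_)
  rw [dualExponent] at h
  linear_combination h

theorem notMem_polarLines {p : ℂ × ℂ} (hs : 1 < p.1.re) (hw : 1 < p.2.re) : p ∉ polarLines := by
  rintro (h | ⟨j, h⟩ | ⟨j, h⟩)
  · simp [h] at hs
  · rw [h] at hw
    simp at hw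
    linarith [j.cast_nonneg (α := ℝ)]
  · rw [h] at hw
    simp at hw
    linarith [j.cast_nonneg (α := ℝ)]

theorem exists_mem_extendedDomain (p : ℂ × ℂ) : ∃ K : ℕ, p ∈ extendedDomain K := by
  obtain ⟨K, hK⟩ := exists_nat_gt (max (1 - 2 * p.1.re) (2 - 2 * p.1.re - p.2.re))
  rw [max_lt_iff] at hK
  exact ⟨K, mem_extendedDomain.2 ⟨by linarith, by linarith⟩⟩

theorem two_two_mem_extendedDomain (K : ℕ) : ((2 : ℂ), (2 : ℂ)) ∈ extendedDomain K := by
  rw [mem_extendedDomain]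
  have : (0 : ℝ) ≤ K := K.cast_nonneg
  simp only [re_ofNat]
  constructor <;> linarith

theorem eventually_one_lt_re : ∀ᶠ p : ℂ × ℂ in 𝓝 (2, 2), 1 < p.1.re ∧ 1 < p.2.re := by
  have h1 : Continuous fun p : ℂ × ℂ => p.1.re := by fun_prop
  have h2 : Continuous fun p : ℂ × ℂ => p.2.re := by fun_prop
  exact (h1.continuousAt.eventually (lt_mem_nhds (by simp))).and
    (h2.continuousAt.eventually (lt_mem_nhds (by simp)))

theorem analyticOnNhd_extendedSeries (K : ℕ) :
    AnalyticOnNhd ℂ (extendedSeries K) (extendedDomain K) := fun _ hp =>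
  analyticAt_of_differentiableOn (isOpen_extendedDomain K) (differentiableOn_extendedSeries K) hp

theorem analyticAt_poleDenom (K : ℕ) (p : ℂ × ℂ) : AnalyticAt ℂ (poleDenom K) p :=
  analyticAt_of_differentiableOn isOpen_univ (differentiable_poleDenom K).differentiableOn
    (mem_univ p)

theorem extendedSeries_mul_poleDenom {K K' : ℕ} {p : ℂ × ℂ} (hp : p ∈ extendedDomain K)
    (hp' : p ∈ extendedDomain K') :
    extendedSeries K p * poleDenom K' p = extendedSeries K' p * poleDenom K p := by
  have h1 : AnalyticOnNhd ℂ (fun p => extendedSeries K p * poleDenom K' p)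
      (extendedDomain K ∩ extendedDomain K') := fun q hq =>
    (analyticOnNhd_extendedSeries K q hq.1).mul (analyticAt_poleDenom K' q)
  have h2 : AnalyticOnNhd ℂ (fun p => extendedSeries K' p * poleDenom K p)
      (extendedDomain K ∩ extendedDomain K') := fun q hq =>
    (analyticOnNhd_extendedSeries K' q hq.2).mul (analyticAt_poleDenom K q)
  refine h1.eqOn_of_preconnected_of_eventuallyEq h2
    ((convex_extendedDomain K).inter (convex_extendedDomain K')).isPreconnected
    ⟨two_two_mem_extendedDomain K, two_two_mem_extendedDomain K'⟩ ?_ ⟨hp, hp'⟩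
  filter_upwards [eventually_one_lt_re] with q hq
  obtain ⟨s, w⟩ := q
  rw [extendedSeries_eq K hq.1 hq.2, extendedSeries_eq K' hq.1 hq.2]
  ring

/-- The meromorphic continuation of the double series. -/
noncomputable def continuedSeries (p : ℂ × ℂ) : ℂ :=
  open Classical in
  extendedSeries (Nat.find (exists_mem_extendedDomain p)) p /
    poleDenom (Nat.find (exists_mem_extendedDomain p)) p

theorem continuedSeries_eq {K : ℕ} {p : ℂ × ℂ} (hp : p ∈ extendedDomain K)
    (hK : poleDenom K p ≠ 0) : continuedSeries p = extendedSeries K p / poleDenom K p := by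
  classical
  have hle : Nat.find (exists_mem_extendedDomain p) ≤ K := Nat.find_min' _ hp
  have h0 : poleDenom (Nat.find (exists_mem_extendedDomain p)) p ≠ 0 := by
    intro h
    refine hK ?_
    rw [poleDenom] at h ⊢
    rw [poleProd_eq_mul hle, ← mul_assoc, h, zero_mul]
  rw [continuedSeries, div_eq_div_iff h0 hK]
  exact extendedSeries_mul_poleDenom (Nat.find_spec (exists_mem_extendedDomain p)) hp

theorem isMeromorphic_continuedSeries : IsMeromorphic continuedSeries := by
  intro p
  obtain ⟨K, hK⟩ := exists_mem_extendedDomain p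
  refine ⟨extendedSeries K, poleDenom K, analyticOnNhd_extendedSeries K p hK,
    analyticAt_poleDenom K p, fun h => ?_, ?_⟩
  · have h0 : poleDenom K = fun _ => 0 :=
      AnalyticOnNhd.eq_of_eventuallyEq (fun q _ => analyticAt_poleDenom K q)
        (fun q _ => analyticAt_const) h
    exact poleDenom_ne_zero (K := K) (p := (2, 2)) (notMem_polarLines (by simp) (by simp))
      (congrFun h0 _)
  · filter_upwards [(isOpen_extendedDomain K).mem_nhds hK] with q hq h
    exact continuedSeries_eq hq h

theorem analyticAt_continuedSeries {p : ℂ × ℂ} (hp : p ∉ polarLines) :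
    AnalyticAt ℂ continuedSeries p := by
  obtain ⟨K, hK⟩ := exists_mem_extendedDomain p
  have h0 := poleDenom_ne_zero (K := K) hp
  refine ((analyticOnNhd_extendedSeries K p hK).div (analyticAt_poleDenom K p) h0).congr ?_
  filter_upwards [(isOpen_extendedDomain K).mem_nhds hK,
    (analyticAt_poleDenom K p).continuousAt.eventually_ne h0] with q hq hq0
  exact (continuedSeries_eq hq hq0).symm

theorem continuedSeries_eq_doubleSeries {s w : ℂ} (hs : 1 < s.re) (hw : 1 < w.re) :
    continuedSeries (s, w) = doubleSeries s w := by
  obtain ⟨K, hK⟩ := exists_mem_extendedDomain (s, w)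
  have h0 := poleDenom_ne_zero (K := K) (notMem_polarLines (p := (s, w)) hs hw)
  rw [continuedSeries_eq hK h0, extendedSeries_eq K hs hw, mul_div_cancel_left₀ _ h0]

/-! ### The normalized series -/

theorem differentiable_normFactor : Differentiable ℂ normFactor := by
  have h1 : Differentiable ℂ fun w : ℂ => (2 : ℂ) ^ (w / 2) :=
    (differentiable_id.div_const 2).const_cpow (Or.inl two_ne_zero)
  have h2 : Differentiable ℂ fun w : ℂ => (Complex.Gamma ((1 - w) / 2))⁻¹ :=
    Complex.differentiable_one_div_Gamma.comp ((differentiable_id.const_sub 1).div_const 2)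
  exact h1.mul h2

theorem analyticAt_normFactor_snd (p : ℂ × ℂ) :
    AnalyticAt ℂ (fun p : ℂ × ℂ => normFactor p.2) p :=
  AnalyticAt.fun_comp (g := normFactor) (f := fun p : ℂ × ℂ => p.2)
    (differentiable_normFactor.analyticAt _) analyticAt_snd

theorem IsMeromorphic.const_mul_analytic {F a : ℂ × ℂ → ℂ} (hF : IsMeromorphic F)
    (ha : ∀ p, AnalyticAt ℂ a p) : IsMeromorphic fun p => a p * F p := by
  intro p
  obtain ⟨g, h, hg, hh, h0, hFgh⟩ := hF p
  refine ⟨fun q => a q * g q, h, (ha p).mul hg, hh, h0, ?_⟩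
  filter_upwards [hFgh] with q hq hq0
  rw [hq hq0, mul_div_assoc]
end
end GaussDDS

/-- The double Dirichlet series of the Hecke `L`-functions `L(s, χ_n)` of `ℚ(i)` converges
absolutely for `Re s > 1`, `Re w > 1` and extends to a meromorphic function on `ℂ²`, and so does
its normalized version; the poles lie on the stated lines. -/
theorem mainTheorem1 :
    (∀ s : ℂ, 1 < s.re → ∀ n : ℤ, Summable fun I : GaussDDS.NonzeroIdeal =>
      GaussDDS.chi n I.1 * (Ideal.absNorm I.1 : ℂ) ^ (-s)) ∧
    (∀ s w : ℂ, 1 < s.re → 1 < w.re → Summable fun n : {n : ℤ // n ≠ 0} =>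
      GaussDDS.heckeL n.1 s * ((n.1.natAbs : ℕ) : ℂ) ^ (-w)) ∧
    (∃ F : ℂ × ℂ → ℂ, GaussDDS.IsMeromorphic F ∧
      (∀ p : ℂ × ℂ, p ∉ GaussDDS.polarLines → AnalyticAt ℂ F p) ∧
      ∀ s w : ℂ, 1 < s.re → 1 < w.re → F (s, w) = GaussDDS.doubleSeries s w) ∧
    (∃ F : ℂ × ℂ → ℂ, GaussDDS.IsMeromorphic F ∧
      (∀ p : ℂ × ℂ, p ∉ GaussDDS.polarLines → AnalyticAt ℂ F p) ∧
      ∀ s w : ℂ, 1 < s.re → 1 < w.re →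
        F (s, w) = GaussDDS.normFactor w * GaussDDS.doubleSeries s w) := by
  refine ⟨fun s hs n => GaussDDS.summable_heckeTerm hs n,
    fun s w hs hw => GaussDDS.summable_doubleSeries hs hw,
    ⟨GaussDDS.continuedSeries, GaussDDS.isMeromorphic_continuedSeries,
      fun p hp => GaussDDS.analyticAt_continuedSeries hp,
      fun s w hs hw => GaussDDS.continuedSeries_eq_doubleSeries hs hw⟩,
    ⟨fun p => GaussDDS.normFactor p.2 * GaussDDS.continuedSeries p,
      GaussDDS.isMeromorphic_continuedSeries.const_mul_analytic GaussDDS.analyticAt_normFactor_snd,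
      fun p hp => (GaussDDS.analyticAt_normFactor_snd p).mul
        (GaussDDS.analyticAt_continuedSeries hp),
      fun s w hs hw => congrArg (GaussDDS.normFactor w * ·)
        (GaussDDS.continuedSeries_eq_doubleSeries hs hw)⟩⟩
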